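/- Let $\alpha,\beta,\gamma>-1$ and $|\delta|<1$. Let $\theta$ denote the sign function, $(z)_m$ the Pochhammer symbol and ${}_2F_1$ the Gauss hypergeometric function. The Big $-1$ Jacobi polynomials $J_n(x)=J_n(x;a,b,c)$ are $$J_n(x)={}_2F_1\!\left({-\tfrac n2,\ \tfrac{n+a+b+2}{2}\atop \tfrac{a+1}{2}};\tfrac{1-x^2}{1-c^2}\right)+\tfrac{n(1-x)}{(1+c)(a+1)}\,{}_2F_1\!\left({1-\tfrac n2,\ \tfrac{n+a+b+2}{2}\atop \tfrac{a+3}{2}};\tfrac{1-x^2}{1-c^2}\right)\quad (n\text{ even}),$$ $$J_n(x)={}_2F_1\!\left({-\tfrac{n-1}2,\ \tfrac{n+a+b+1}{2}\atop \tfrac{a+1}{2}};\tfrac{1-x^2}{1-c^2}\right)-\tfrac{(n+a+b+1)(1-x)}{(1+c)(a+1)}\,{}_2F_1\!\left({-\tfrac{n-1}2,\ \tfrac{n+a+b+3}{2}\atop \tfrac{a+3}{2}};\tfrac{1-x^2}{1-c^2}\right)\quad (n\text{ odd})$$ (for $n=0$ the second summand is $0$). For integers $0\le k\le n$ the two-variable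 Big $-1$ Jacobi polynomials are $$\mathcal J_{n,k}(x,y)=J_{n-k}\big(y;\alpha,2k+\beta+\gamma+1,(-1)^k\delta\big)\,\rho_k(y)\,J_k\!\left(\tfrac xy;\gamma,\beta,\tfrac\delta y\right),$$ where $\rho_k(y)=y^k\big(1-\tfrac{\delta^2}{y^2}\big)^{k/2}$ for $k$ even and $\rho_k(y)=y^k\big(1-\tfrac{\delta^2}{y^2}\big)^{(k-1)/2}\big(1+\tfrac\delta y\big)$ for $k$ odd. Let $$W(x,y)=\theta(xy)\,|y|^{\beta+\gamma}(1+y)\Big(1+\frac xy\Big)\Big(\frac{x-\delta}{y}\Big)(1-y^2)^{\frac{\alpha-1}2}\Big(1-\frac{x^2}{y^2}\Big)^{\frac{\gamma-1}2}\Big(\frac{x^2-\delta^2}{y^2}\Big)^{\frac{\beta-1}2},$$ $$D_y=[-1,-|\delta|]\cup[|\delta|,1],\qquad D_x=D_x(y)=[-|y|,-|\delta|]\cup[|\delta|,|y|],$$ $$h_n(a,b)=\begin{cases}\dfrac{2\,\Gamma(\frac{n+b+1}2)\,\Gamma(\frac{n+a+3}2)\,(\frac n2)!}{(n+a+1)\,\Gamma(\frac{n+a+b+2}2)\,\big(\frac{a+1}2\big)_{n/2}^2},&n\text{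 even},\\[3mm]\dfrac{(n+a+b+1)\,\Gamma(\frac{n+b+2}2)\,\Gamma(\frac{n+a+2}2)\,(\frac{n-1}2)!}{2\,\Gamma(\frac{n+a+b+3}2)\,\big(\frac{a+1}2\big)_{(n+1)/2}^2},&n\text{ odd}.\end{cases}$$ Then: 1. The domain $\{(x,y): y\in D_y,\ x\in D_x(y)\}$ is the union of the four closed triangles with vertices $(s|\delta|,t|\delta|)$, $(s|\delta|,t)$, $(s,t)$, for $s,t\in\{1,-1\}$, and these are pairwise disjoint if $\delta\ne0$. 2. $W(x,y)>0$ whenever $|\delta|<|x|<|y|<1$. 3. For all integers $0\le k\le n$ and $0\le \ell\le m$, the function $\mathcal J_{n,k}\,\mathcal J_{m,\ell}\,W$ is Lebesgue integrable on the domain, and $$\int_{D_y}\int_{D_x}\mathcal J_{n,k}(x,y)\,\mathcal J_{m,\ell}(x,y)\,W(x,y)\,dx\,dy=H_{nk}\,\delta_{k\ell}\,\delta_{nm},$$ $$H_{nk}=\frac{(1-\delta^2)^{\frac{2k+\alpha+\beta+\gamma+3}{2}}}{1+(-1)^k\delta}\;h_k(\gamma,\beta)\;h_{n-k}(\alpha,2k+\beta+\gamma+1),$$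 where $\delta_{k\ell},\delta_{nm}$ are Kronecker symbols. -/

import Mathlib

open MeasureTheory Set

noncomputable section

/-- The one-variable Big -1 Jacobi polynomial `J_n(x; a, b, c)`. Each Gauss series below that is
multiplied by a nonzero factor terminates (for `n = 0` the second summand has the factor `n = 0`). -/
def bigMinusOneJacobi (n : ℕ) (a b c x : ℝ) : ℝ :=
  if Even n then
    ₂F₁ (-(n : ℝ) / 2) ((n + a + b + 2) / 2) ((a + 1) / 2) ((1 - x ^ 2) / (1 - c ^ 2))
      + n * (1 - x) / ((1 + c) * (a + 1))
        * ₂F₁ (1 - (n : ℝ) / 2) ((n + a + b + 2) / 2) ((a + 3) / 2) ((1 - x ^ 2) / (1 - c ^ 2))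
  else
    ₂F₁ (-((n : ℝ) - 1) / 2) ((n + a + b + 1) / 2) ((a + 1) / 2) ((1 - x ^ 2) / (1 - c ^ 2))
      - (n + a + b + 1) * (1 - x) / ((1 + c) * (a + 1))
        * ₂F₁ (-((n : ℝ) - 1) / 2) ((n + a + b + 3) / 2) ((a + 3) / 2)
            ((1 - x ^ 2) / (1 - c ^ 2))

/-- The factor `ρ_k(y)`; the exponents `k / 2` and `(k - 1) / 2` are exact divisions in the
respective parity cases. -/
def bigMinusOneRho (δ : ℝ) (k : ℕ) (y : ℝ) : ℝ :=
  if Even k then y ^ k * (1 - δ ^ 2 / y ^ 2) ^ (k / 2)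
  else y ^ k * (1 - δ ^ 2 / y ^ 2) ^ ((k - 1) / 2) * (1 + δ / y)

/-- The two-variable Big -1 Jacobi polynomial `𝒥_{n,k}(x, y)`, for `k ≤ n`. The formula
is meant for `y ≠ 0`, `y ≠ δ`, `y ≠ -δ`; these lines are Lebesgue null sets in the plane. -/
def bivariateBigMinusOneJacobi (α β γ δ : ℝ) (n k : ℕ) (x y : ℝ) : ℝ :=
  bigMinusOneJacobi (n - k) α (2 * k + β + γ + 1) ((-1) ^ k * δ) y
    * bigMinusOneRho δ k y
    * bigMinusOneJacobi k γ β (δ / y) (x / y)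

/-- The weight function `W(x, y)`. -/
def bigMinusOneWeight (α β γ δ x y : ℝ) : ℝ :=
  Real.sign (x * y) * |y| ^ (β + γ) * (1 + y) * (1 + x / y) * ((x - δ) / y)
    * (1 - y ^ 2) ^ ((α - 1) / 2)
    * (1 - x ^ 2 / y ^ 2) ^ ((γ - 1) / 2)
    * ((x ^ 2 - δ ^ 2) / y ^ 2) ^ ((β - 1) / 2)

/-- The set `D_y`. -/
def bigMinusOneDy (δ : ℝ) : Set ℝ := Icc (-1) (-|δ|) ∪ Icc |δ| 1

/-- The set `D_x`, which depends on `y`. -/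
def bigMinusOneDx (δ y : ℝ) : Set ℝ := Icc (-|y|) (-|δ|) ∪ Icc |δ| |y|

/-- The planar integration domain described by `D_x` and `D_y`. -/
def bigMinusOneDomain (δ : ℝ) : Set (ℝ × ℝ) :=
  {p | p.2 ∈ bigMinusOneDy δ ∧ p.1 ∈ bigMinusOneDx δ p.2}

/-- The closed triangle with vertices `(s|δ|, t|δ|)`, `(s|δ|, t)`, `(s, t)`, used for the signs
`s, t = ±1`. -/
def bigMinusOneTriangle (δ : ℝ) (s t : ℤˣ) : Set (ℝ × ℝ) :=
  convexHull ℝ {(((s : ℤ) : ℝ) * |δ|, ((t : ℤ) : ℝ) * |δ|),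
    (((s : ℤ) : ℝ) * |δ|, ((t : ℤ) : ℝ)), (((s : ℤ) : ℝ), ((t : ℤ) : ℝ))}

/-- The normalization factor `h_n(a, b)`; the Pochhammer symbol `(z)_m` is
`(ascPochhammer ℝ m).eval z`. -/
def bigMinusOneH (n : ℕ) (a b : ℝ) : ℝ :=
  if Even n then
    2 * Real.Gamma ((n + b + 1) / 2) * Real.Gamma ((n + a + 3) / 2) * (Nat.factorial (n / 2) : ℝ)
      / ((n + a + 1) * Real.Gamma ((n + a + b + 2) / 2)
          * ((ascPochhammer ℝ (n / 2)).eval ((a + 1) / 2)) ^ 2)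
  else
    (n + a + b + 1) * Real.Gamma ((n + b + 2) / 2) * Real.Gamma ((n + a + 2) / 2)
        * (Nat.factorial ((n - 1) / 2) : ℝ)
      / (2 * Real.Gamma ((n + a + b + 3) / 2)
          * ((ascPochhammer ℝ ((n + 1) / 2)).eval ((a + 1) / 2)) ^ 2)

/-- The normalization factor `H_{nk}`. -/
def bivariateBigMinusOneH (α β γ δ : ℝ) (n k : ℕ) : ℝ :=
  (1 - δ ^ 2) ^ ((2 * k + α + β + γ + 3) / 2) / (1 + (-1) ^ k * δ)
    * bigMinusOneH k γ β * bigMinusOneH (n - k) α (2 * k + β + γ + 1)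

end

/-! One variable. Put p = (a+1)/2, r = (b+1)/2, t = (1-x²)/(1-c²). Contiguous relations give J_n =
U_n(t) - (1-x)(x+c)/(1-c²) · P_n(t), where U_n is the Jacobi polynomial of degree ⌈n/2⌉ for t^(p-1)
(1-t)^(r-1) and P_n is a multiple of a Jacobi polynomial with both parameters raised by one
(`bigMinusOneJacobi_eq_eval`). Folding x < 0 onto x > 0 kills the cross terms and leaves, up to a
constant, the beta integral of U_n U_m + t(1-t) P_n P_m (`bigMinusOneJacobi_orthogonality`).

Differentiation carries U_n to a multiple of the raised Jacobi polynomial, so the two integrals are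
proportional. Jacobi orthogonality makes both vanish unless n = m or {n, m} = {2N+1, 2N+2}. In such
a pair the scalars in P_n and P_m have opposite signs and the two integrals cancel; for n = m they
add up to h_n (`betaMoment_main_add_aux`).

Two variables. The substitution x = yu turns each fibre into the one-variable problem with c = δ/y.
The fibre norm, the Jacobian and ρ_k² combine into the one-variable weight in y with parameters
2k+β+γ+1 and (-1)^k δ (`bigMinusOneRho_sq_mul`), so one-variable orthogonality applies a second
time. Since W ≥ 0, Tonelli gives integrability of the squares, which dominate all products.

The domain is |δ| ≤ |x| ≤ |y| ≤ 1; each choice of signs of x and y cuts out one triangle. -/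

/-! ### Pochhammer symbols and hypergeometric coefficients. -/

theorem ascPochhammer_eval_succ_left (x : ℝ) (i : ℕ) :
    (ascPochhammer ℝ (i + 1)).eval x = x * (ascPochhammer ℝ i).eval (x + 1) := by
  rw [ascPochhammer_succ_left]; simp

theorem ascPochhammer_eval_succ_right (x : ℝ) (i : ℕ) :
    (ascPochhammer ℝ (i + 1)).eval x = (ascPochhammer ℝ i).eval x * (x + i) := by
  rw [ascPochhammer_succ_right]; simp

theorem ordinaryHypergeometricCoefficient_comm (a b c : ℝ) (i : ℕ) :
    ordinaryHypergeometricCoefficient a b c i = ordinaryHypergeometricCoefficient b a c i := by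
  unfold ordinaryHypergeometricCoefficient; ring

theorem ordinaryHypergeometricCoefficient_succ (a b : ℝ) {c : ℝ} (hc : 0 < c) (i : ℕ) :
    (i + 1) * (c + i) * ordinaryHypergeometricCoefficient a b c (i + 1)
      = (a + i) * (b + i) * ordinaryHypergeometricCoefficient a b c i := by
  have h1 := (ascPochhammer_pos i c hc).ne'
  have h2 : c + i ≠ 0 := by positivity
  have h3 : (i.factorial : ℝ) ≠ 0 := by positivity
  simp only [ordinaryHypergeometricCoefficient, ascPochhammer_eval_succ_right, Nat.factorial_succ]
  push_cast
  field_simp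

theorem ordinaryHypergeometricCoefficient_shift (a b : ℝ) {c : ℝ} (hc : 0 < c) (i : ℕ) :
    (i + 1) * ordinaryHypergeometricCoefficient a b c (i + 1)
      = a * b / c * ordinaryHypergeometricCoefficient (a + 1) (b + 1) (c + 1) i := by
  have h1 := (ascPochhammer_pos i (c + 1) (by positivity)).ne'
  have h3 : (i.factorial : ℝ) ≠ 0 := by positivity
  simp only [ordinaryHypergeometricCoefficient, ascPochhammer_eval_succ_left, Nat.factorial_succ]
  push_cast
  field_simp

/-- Coefficient form of F(a,b+1;c) - (a/c) X F(a+1,b+1;c+1) = F(a,b;c). Exchanging the roles of a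
and b yields the two polynomial relations needed for even and odd n. -/
theorem ordinaryHypergeometricCoefficient_contiguous (a b : ℝ) {c : ℝ} (hc : 0 < c) (i : ℕ) :
    ordinaryHypergeometricCoefficient a (b + 1) c (i + 1)
        - a / c * ordinaryHypergeometricCoefficient (a + 1) (b + 1) (c + 1) i
      = ordinaryHypergeometricCoefficient a b c (i + 1) := by
  have h1 := (ascPochhammer_pos i (c + 1) (by positivity)).ne'
  have h3 : (i.factorial : ℝ) ≠ 0 := by positivity
  simp only [ordinaryHypergeometricCoefficient, ascPochhammer_eval_succ_left a,
    ascPochhammer_eval_succ_left b, ascPochhammer_eval_succ_left c,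
    ascPochhammer_eval_succ_right (b + 1), Nat.factorial_succ]
  push_cast
  field_simp
  ring

/-! ### Terminating Gauss series: differential equation, derivative, contiguous relations. -/

noncomputable section

open Polynomial

/-- The terminating Gauss series `₂F₁(-N, b; c; X)` as a polynomial. -/
def terminatingHypergeometric (N : ℕ) (b c : ℝ) : ℝ[X] :=
  ∑ i ∈ Finset.range (N + 1), monomial i (ordinaryHypergeometricCoefficient (-(N : ℝ)) b c i)

/-- The Jacobi polynomial of degree `N` for the weight `t ^ (p - 1) * (1 - t) ^ (r - 1)` on
`[0, 1]`, normalized to the value `1` at `0`. -/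
def shiftedJacobi (N : ℕ) (p r : ℝ) : ℝ[X] := terminatingHypergeometric N (N + p + r - 1) p

theorem ordinaryHypergeometricCoefficient_neg_nat {N i : ℕ} (h : N < i) (b c : ℝ) :
    ordinaryHypergeometricCoefficient (-(N : ℝ)) b c i = 0 := by
  simp [ordinaryHypergeometricCoefficient,
    (ascPochhammer_eval_eq_zero_iff i (-(N : ℝ))).2 ⟨N, h, by simp⟩]

theorem coeff_terminatingHypergeometric (N : ℕ) (b c : ℝ) (i : ℕ) :
    (terminatingHypergeometric N b c).coeff i
      = ordinaryHypergeometricCoefficient (-(N : ℝ)) b c i := by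
  simp only [terminatingHypergeometric, finsetSum_coeff, coeff_monomial, Finset.sum_ite_eq',
    Finset.mem_range]
  split_ifs with h
  · rfl
  · rw [ordinaryHypergeometricCoefficient_neg_nat (by lia)]

theorem eval_terminatingHypergeometric (N : ℕ) (b c x : ℝ) :
    (terminatingHypergeometric N b c).eval x = ₂F₁ (-(N : ℝ)) b c x := by
  rw [ordinaryHypergeometric_eq_tsum]
  dsimp only
  rw [tsum_eq_sum (s := Finset.range (N + 1))]
  · simp [terminatingHypergeometric, eval_finsetSum]
  · intro i hi
    have h := ordinaryHypergeometricCoefficient_neg_nat (N := N) (i := i) (by simpa using hi) b c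
    unfold ordinaryHypergeometricCoefficient at h
    rw [h, zero_smul]

/-- Comparing coefficients, the hypergeometric equation is the two-term recurrence of the
coefficients. -/
theorem terminatingHypergeometric_ode (N : ℕ) (b : ℝ) {c : ℝ} (hc : 0 < c) :
    X * derivative (derivative (terminatingHypergeometric N b c))
      - X ^ 2 * derivative (derivative (terminatingHypergeometric N b c))
      + C c * derivative (terminatingHypergeometric N b c)
      - C (b - N + 1) * (X * derivative (terminatingHypergeometric N b c))
      + C (N * b) * terminatingHypergeometric N b c = 0 := by
  have h (i : ℕ) := ordinaryHypergeometricCoefficient_succ (-(N : ℝ)) b hc i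
  simp only [← coeff_terminatingHypergeometric] at h
  generalize terminatingHypergeometric N b c = f at h ⊢
  obtain ⟨e, he⟩ : ∃ e, e = b - N + 1 := ⟨_, rfl⟩
  obtain ⟨g, hg⟩ : ∃ g, g = N * b := ⟨_, rfl⟩
  rw [← he, ← hg]
  ext i
  specialize h i
  rcases i with _ | _ | i <;>
    simp only [pow_two, mul_assoc, coeff_add, coeff_sub, coeff_C_mul, coeff_X_mul, coeff_X_mul_zero,
      coeff_derivative, coeff_zero, he, hg] at h ⊢ <;>
    push_cast at h ⊢ <;>
    linear_combination h

theorem derivative_terminatingHypergeometric (N : ℕ) (b : ℝ) {c : ℝ} (hc : 0 < c) :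
    derivative (terminatingHypergeometric (N + 1) b c)
      = C (-(N + 1) * b / c) * terminatingHypergeometric N (b + 1) (c + 1) := by
  ext i
  have h := ordinaryHypergeometricCoefficient_shift (-((N : ℝ) + 1)) b hc i
  rw [show -((N : ℝ) + 1) + 1 = -N by ring] at h
  rw [coeff_derivative, coeff_C_mul, coeff_terminatingHypergeometric,
    coeff_terminatingHypergeometric]
  push_cast
  linear_combination h

theorem terminatingHypergeometric_contiguous_upper (N : ℕ) (b : ℝ) {c : ℝ} (hc : 0 < c) :
    terminatingHypergeometric (N + 1) (b + 1) c
        + C ((N + 1) / c) * (X * terminatingHypergeometric N (b + 1) (c + 1))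
      = terminatingHypergeometric (N + 1) b c := by
  ext i
  rcases i with _ | i
  · simp [coeff_terminatingHypergeometric]
  · have h := ordinaryHypergeometricCoefficient_contiguous (-((N : ℝ) + 1)) b hc i
    rw [show -((N : ℝ) + 1) + 1 = -N by ring] at h
    rw [coeff_add, coeff_C_mul, coeff_X_mul]
    simp only [coeff_terminatingHypergeometric]
    push_cast
    linear_combination h

theorem terminatingHypergeometric_contiguous_lower (N : ℕ) (b : ℝ) {c : ℝ} (hc : 0 < c) :
    terminatingHypergeometric N b c
        - C (b / c) * (X * terminatingHypergeometric N (b + 1) (c + 1))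
      = terminatingHypergeometric (N + 1) b c := by
  ext i
  rcases i with _ | i
  · simp [coeff_terminatingHypergeometric]
  · have h := ordinaryHypergeometricCoefficient_contiguous b (-((N : ℝ) + 1)) hc i
    rw [show -((N : ℝ) + 1) + 1 = -N by ring] at h
    rw [coeff_sub, coeff_C_mul, coeff_X_mul]
    simp only [coeff_terminatingHypergeometric]
    rw [ordinaryHypergeometricCoefficient_comm (-(N : ℝ)) b,
      ordinaryHypergeometricCoefficient_comm (-(N : ℝ)) (b + 1),
      ordinaryHypergeometricCoefficient_comm _ b]
    push_cast
    linear_combination h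

end

/-! ### Beta integrals and Jacobi polynomials on the unit interval. -/

noncomputable section

open Polynomial

/-- The weight `t ^ (p - 1) * (1 - t) ^ (r - 1)` of the Euler beta integral. -/
def betaWeight (p r t : ℝ) : ℝ := t ^ (p - 1) * (1 - t) ^ (r - 1)

/-- The integral of a polynomial against the beta weight on `(0, 1)`. -/
def betaMoment (p r : ℝ) (f : ℝ[X]) : ℝ := ∫ t in Ioo (0 : ℝ) 1, f.eval t * betaWeight p r t

theorem ofReal_betaWeight {p r t : ℝ} (ht : t ∈ Ioo (0 : ℝ) 1) :
    ((betaWeight p r t : ℝ) : ℂ) = (t : ℂ) ^ ((p : ℂ) - 1) * (1 - (t : ℂ)) ^ ((r : ℂ) - 1) := by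
  rw [betaWeight, Complex.ofReal_mul, Complex.ofReal_cpow ht.1.le,
    Complex.ofReal_cpow (sub_nonneg.2 ht.2.le)]
  push_cast
  rfl

theorem integrableOn_betaWeight {p r : ℝ} (hp : 0 < p) (hr : 0 < r) :
    IntegrableOn (betaWeight p r) (Ioo 0 1) := by
  have h := Complex.betaIntegral_convergent (u := p) (v := r) (by simpa) (by simpa)
  rw [intervalIntegrable_iff_integrableOn_Ioo_of_le zero_le_one] at h
  refine IntegrableOn.congr_fun h.re (fun t ht => ?_) measurableSet_Ioo
  rw [← Complex.ofReal_re (betaWeight p r t), ofReal_betaWeight ht]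
  rfl

theorem betaMoment_one {p r : ℝ} (hp : 0 < p) (hr : 0 < r) :
    betaMoment p r 1 = Real.Gamma p * Real.Gamma r / Real.Gamma (p + r) := by
  have h1 : ((betaMoment p r 1 : ℝ) : ℂ) = Complex.betaIntegral p r := by
    rw [betaMoment, Complex.betaIntegral, intervalIntegral.integral_of_le zero_le_one,
      integral_Ioc_eq_integral_Ioo, ← integral_complex_ofReal]
    refine setIntegral_congr_fun measurableSet_Ioo fun t ht => ?_
    simp only [eval_one, one_mul]
    exact ofReal_betaWeight ht
  have h2 := ProbabilityTheory.beta_eq_betaIntegralReal p r hp hr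
  rw [← h1, Complex.ofReal_re] at h2
  rw [← h2, ProbabilityTheory.beta]

theorem integrableOn_eval_mul_betaWeight {p r : ℝ} (hp : 0 < p) (hr : 0 < r) (f : ℝ[X]) :
    IntegrableOn (fun t => f.eval t * betaWeight p r t) (Ioo 0 1) := by
  obtain ⟨c, hc⟩ := isCompact_Icc.exists_bound_of_continuousOn (s := Icc (0 : ℝ) 1)
    (f := fun t => f.eval t) f.continuous.continuousOn
  refine Integrable.bdd_mul (c := c) (integrableOn_betaWeight hp hr)
    f.continuous.aestronglyMeasurable ?_
  exact ae_restrict_of_forall_mem measurableSet_Ioo fun t ht => hc t (Ioo_subset_Icc_self ht)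

theorem betaMoment_add {p r : ℝ} (hp : 0 < p) (hr : 0 < r) (f g : ℝ[X]) :
    betaMoment p r (f + g) = betaMoment p r f + betaMoment p r g := by
  rw [betaMoment, betaMoment, betaMoment,
    ← integral_add (integrableOn_eval_mul_betaWeight hp hr f)
      (integrableOn_eval_mul_betaWeight hp hr g)]
  simp only [eval_add, add_mul]

theorem betaMoment_C_mul (p r c : ℝ) (f : ℝ[X]) :
    betaMoment p r (C c * f) = c * betaMoment p r f := by
  rw [betaMoment, betaMoment, ← integral_const_mul]
  simp only [eval_mul, eval_C, mul_assoc]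

theorem betaMoment_shift {p r : ℝ} (f : ℝ[X]) :
    betaMoment (p + 1) (r + 1) f = betaMoment p r (X * (1 - X) * f) := by
  refine setIntegral_congr_fun measurableSet_Ioo fun t ht => ?_
  have h0 : t ≠ 0 := ht.1.ne'
  have h1 : 1 - t ≠ 0 := (sub_pos.2 ht.2).ne'
  simp only [betaWeight, eval_mul, eval_sub, eval_X, eval_one, add_sub_cancel_right,
    Real.rpow_sub_one h0, Real.rpow_sub_one h1]
  field_simp

theorem hasDerivAt_betaWeight {p r t : ℝ} (ht : t ∈ Ioo (0 : ℝ) 1) :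
    HasDerivAt (betaWeight (p + 1) (r + 1)) ((p - (p + r) * t) * betaWeight p r t) t := by
  have h0 : t ≠ 0 := ht.1.ne'
  have h1 : 1 - t ≠ 0 := (sub_pos.2 ht.2).ne'
  have h := ((hasDerivAt_id t).rpow_const (p := p) (Or.inl h0)).mul
    (((hasDerivAt_id t).const_sub 1).rpow_const (p := r) (Or.inl h1))
  have e : betaWeight (p + 1) (r + 1) = (fun x => id x ^ p) * fun x => (1 - id x) ^ r := by
    ext x; simp [betaWeight]
  rw [e]
  refine h.congr_deriv ?_
  simp only [betaWeight, id, Real.rpow_sub_one h0, Real.rpow_sub_one h1]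
  field_simp
  ring

/-- The integrand is the derivative of f(t) t^p (1-t)^r, which vanishes at 0 and 1 because p and r
are positive. -/
theorem betaMoment_integration_by_parts {p r : ℝ} (hp : 0 < p) (hr : 0 < r) (f : ℝ[X]) :
    betaMoment p r ((C p - C (p + r) * X) * f + X * (1 - X) * derivative f) = 0 := by
  set F : ℝ → ℝ := fun t => f.eval t * betaWeight (p + 1) (r + 1) t with hF
  have hcont : ContinuousOn F (Icc 0 1) := by
    refine f.continuous.continuousOn.mul (Continuous.continuousOn ?_)
    unfold betaWeight
    simp only [add_sub_cancel_right]
    exact (continuous_id.rpow_const fun _ => Or.inr hp.le).mul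
      ((continuous_const.sub continuous_id).rpow_const fun _ => Or.inr hr.le)
  set G := ((C p - C (p + r) * X) * f + X * (1 - X) * derivative f)
  have hderiv : ∀ t ∈ Ioo (0 : ℝ) 1, HasDerivAt F (G.eval t * betaWeight p r t) t := by
    intro t ht
    have h0 : t ≠ 0 := ht.1.ne'
    have h1 : 1 - t ≠ 0 := (sub_pos.2 ht.2).ne'
    refine ((f.hasDerivAt t).mul (hasDerivAt_betaWeight (p := p) (r := r) ht)).congr_deriv ?_
    simp only [G, eval_add, eval_mul, eval_sub, eval_C, eval_X, eval_one, betaWeight,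
      add_sub_cancel_right, Real.rpow_sub_one h0, Real.rpow_sub_one h1]
    field_simp
    ring
  have h := intervalIntegral.integral_eq_sub_of_hasDerivAt_of_le zero_le_one hcont hderiv
    ((intervalIntegrable_iff_integrableOn_Ioo_of_le zero_le_one).2
      (integrableOn_eval_mul_betaWeight hp hr G))
  rw [intervalIntegral.integral_of_le zero_le_one, integral_Ioc_eq_integral_Ioo] at h
  rw [betaMoment, h]
  simp [hF, betaWeight, hp.ne', hr.ne']

/-- Self-adjointness of the Jacobi operator: integrate (f' g) by parts for f the Jacobi polynomial;
the differential equation turns (t^p (1-t)^r f')' into -N(N+p+r-1) f times the beta weight. -/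
theorem betaMoment_derivative_mul_derivative {p r : ℝ} (hp : 0 < p) (hr : 0 < r) (N : ℕ)
    (g : ℝ[X]) :
    betaMoment (p + 1) (r + 1) (derivative (shiftedJacobi N p r) * derivative g)
      = N * (N + p + r - 1) * betaMoment p r (shiftedJacobi N p r * g) := by
  have h := betaMoment_integration_by_parts hp hr (derivative (shiftedJacobi N p r) * g)
  have hode := terminatingHypergeometric_ode N (N + p + r - 1) hp
  change X * derivative (derivative (shiftedJacobi N p r)) - _ * derivative (derivative
    (shiftedJacobi N p r)) + _ * derivative (shiftedJacobi N p r) - _ * (_ * derivative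
    (shiftedJacobi N p r)) + _ * shiftedJacobi N p r = 0 at hode
  rw [show (N : ℝ) + p + r - 1 - N + 1 = p + r by ring] at hode
  rw [betaMoment_shift, ← betaMoment_C_mul]
  generalize shiftedJacobi N p r = f at *
  have e : X * (1 - X) * (derivative f * derivative g)
      = ((C p - C (p + r) * X) * (derivative f * g) + X * (1 - X) * derivative (derivative f * g))
        + C (↑N * (↑N + p + r - 1)) * (f * g) := by
    rw [derivative_mul]
    linear_combination -g * hode
  rw [e, betaMoment_add hp hr, h, zero_add]

theorem derivative_shiftedJacobi_succ (N : ℕ) {p : ℝ} (r : ℝ) (hp : 0 < p) :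
    derivative (shiftedJacobi (N + 1) p r)
      = C (-(N + 1) * (N + p + r) / p) * shiftedJacobi N (p + 1) (r + 1) := by
  have h := derivative_terminatingHypergeometric N (N + p + r) hp
  rw [shiftedJacobi, shiftedJacobi]
  convert h using 3 <;> push_cast <;> ring

/-- Take g = f in the previous energy identity: f' is again a Jacobi polynomial, with raised
parameters. This proportionality of norms drives both the norm formula and the later cancellation.
-/
theorem betaMoment_shiftedJacobi_succ {p r : ℝ} (hp : 0 < p) (hr : 0 < r) (N : ℕ) :
    betaMoment p r (shiftedJacobi (N + 1) p r * shiftedJacobi (N + 1) p r)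
      = (N + 1) * (N + p + r) / p ^ 2 * betaMoment (p + 1) (r + 1)
          (shiftedJacobi N (p + 1) (r + 1) * shiftedJacobi N (p + 1) (r + 1)) := by
  have h := betaMoment_derivative_mul_derivative hp hr (N + 1) (shiftedJacobi (N + 1) p r)
  rw [derivative_shiftedJacobi_succ N r hp, mul_mul_mul_comm, ← C_mul, betaMoment_C_mul] at h
  have h1 : (N : ℝ) + 1 ≠ 0 := by positivity
  have h2 : (N : ℝ) + p + r ≠ 0 := by positivity
  push_cast at h
  rw [show (N : ℝ) + 1 + p + r - 1 = N + p + r by ring] at h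
  apply mul_left_cancel₀ (mul_ne_zero h1 h2)
  rw [← h]
  field_simp

/-- The energy form is symmetric, so its two evaluations differ by the eigenvalue gap
(N-M)(N+M+p+r-1), which is nonzero since N+M ≥ 1 and p+r > 0. -/
theorem betaMoment_shiftedJacobi_of_ne {p r : ℝ} (hp : 0 < p) (hr : 0 < r) {N M : ℕ}
    (h : N ≠ M) : betaMoment p r (shiftedJacobi N p r * shiftedJacobi M p r) = 0 := by
  have h1 := betaMoment_derivative_mul_derivative hp hr N (shiftedJacobi M p r)
  have h2 := betaMoment_derivative_mul_derivative hp hr M (shiftedJacobi N p r)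
  rw [mul_comm (derivative _), mul_comm (shiftedJacobi M p r)] at h2
  have h3 : ((N : ℝ) - M) * (N + M + p + r - 1) *
      betaMoment p r (shiftedJacobi N p r * shiftedJacobi M p r) = 0 := by
    linear_combination h2 - h1
  have h4 : (N : ℝ) - M ≠ 0 := sub_ne_zero.2 (by exact_mod_cast h)
  have h5 : (1 : ℝ) ≤ N + M := by exact_mod_cast (by lia : 1 ≤ N + M)
  have h6 : (N : ℝ) + M + p + r - 1 ≠ 0 := by
    have : 0 < (N : ℝ) + M + p + r - 1 := by linarith
    exact this.ne'
  simpa [h4, h6] using h3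

theorem shiftedJacobi_zero (p r : ℝ) : shiftedJacobi 0 p r = 1 := by
  simp [shiftedJacobi, terminatingHypergeometric, ordinaryHypergeometricCoefficient]

/-- Each induction step lowers N and raises both parameters, down to the Euler beta integral. The
condition 1 < p + r keeps the argument of Γ(N+p+r-1) positive already at N = 0; it is automatic for
the raised parameters at which the formula is used. -/
theorem betaMoment_shiftedJacobi_sq (N : ℕ) : ∀ {p r : ℝ}, 0 < p → 0 < r → 1 < p + r →
    (2 * N + p + r - 1) * betaMoment p r (shiftedJacobi N p r * shiftedJacobi N p r)
      = N.factorial * Real.Gamma (N + p) * Real.Gamma (N + r)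
        / (((ascPochhammer ℝ N).eval p) ^ 2 * Real.Gamma (N + p + r - 1)) := by
  induction N with
  | zero =>
    intro p r hp hr h
    have h1 : p + r - 1 ≠ 0 := by linarith
    have h2 : Real.Gamma (p + r) = (p + r - 1) * Real.Gamma (p + r - 1) := by
      rw [← Real.Gamma_add_one h1, sub_add_cancel]
    have h3 : Real.Gamma (p + r - 1) ≠ 0 := (Real.Gamma_pos_of_pos (by linarith)).ne'
    simp only [shiftedJacobi_zero, mul_one, betaMoment_one hp hr, h2]
    simp
    field_simp
  | succ N ih =>
    intro p r hp hr h
    have ih := ih (p := p + 1) (r := r + 1) (by positivity) (by positivity) (by linarith)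
    have h1 : (N : ℝ) + p + r ≠ 0 := by positivity
    have h3 : Real.Gamma (N + p + r) ≠ 0 := (Real.Gamma_pos_of_pos (by positivity)).ne'
    have h4 := (ascPochhammer_pos N (p + 1) (by positivity)).ne'
    rw [betaMoment_shiftedJacobi_succ hp hr, ascPochhammer_eval_succ_left, Nat.factorial_succ]
    push_cast
    rw [show (N : ℝ) + (p + 1) + (r + 1) - 1 = (N + p + r) + 1 by ring, Real.Gamma_add_one h1] at ih
    rw [show (N : ℝ) + 1 + p + r - 1 = N + p + r by ring,
      show (N : ℝ) + 1 + p = N + (p + 1) by ring, show (N : ℝ) + 1 + r = N + (r + 1) by ring]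
    have e : (2 * ((N : ℝ) + 1) + p + r - 1) * ((N + 1) * (N + p + r) / p ^ 2 * betaMoment (p + 1)
        (r + 1) (shiftedJacobi N (p + 1) (r + 1) * shiftedJacobi N (p + 1) (r + 1)))
        = (N + 1) * (N + p + r) / p ^ 2 * ((2 * N + (p + 1) + (r + 1) - 1) * betaMoment (p + 1)
        (r + 1) (shiftedJacobi N (p + 1) (r + 1) * shiftedJacobi N (p + 1) (r + 1))) := by ring
    rw [e, ih]
    field_simp

end

/-! ### The splitting of J_n and its quadratic form. -/

noncomputable section

open Polynomial

/-- The Jacobi polynomial that `J_n` contributes to the first beta integral of the quadratic form. -/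
def bigMinusOneMain (n : ℕ) (p r : ℝ) : ℝ[X] := shiftedJacobi ((n + 1) / 2) p r

/-- The scalar in front of the Jacobi polynomial with raised parameters in `J_n`. -/
def bigMinusOneFactor (n : ℕ) (p r : ℝ) : ℝ :=
  if Even n then ((n / 2 : ℕ) : ℝ) / p else -(((n / 2 : ℕ) : ℝ) + p + r) / p

/-- The multiple of `1 - x` in `J_n`, as a polynomial in `(1 - x ^ 2) / (1 - c ^ 2)`. -/
def bigMinusOneAux (n : ℕ) (p r : ℝ) : ℝ[X] :=
  C (bigMinusOneFactor n p r) * shiftedJacobi ((n - 1) / 2) (p + 1) (r + 1)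

/-- The second series of J_n is the raised Jacobi polynomial, and a contiguous relation writes the
first as U - tP. The identity is formal in t and (1-x)/(1+c), so no condition on c is needed. -/
theorem bigMinusOneJacobi_eq_eval (n : ℕ) {a : ℝ} (ha : -1 < a) (b c x : ℝ) :
    bigMinusOneJacobi n a b c x
      = (bigMinusOneMain n ((a + 1) / 2) ((b + 1) / 2)
            - X * bigMinusOneAux n ((a + 1) / 2) ((b + 1) / 2)).eval ((1 - x ^ 2) / (1 - c ^ 2))
        + (1 - x) / (1 + c)
          * (bigMinusOneAux n ((a + 1) / 2) ((b + 1) / 2)).eval ((1 - x ^ 2) / (1 - c ^ 2)) := by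
  have ha1 : a + 1 ≠ 0 := by linarith
  have hp : 0 < (a + 1) / 2 := by linarith
  generalize ht : (1 - x ^ 2) / (1 - c ^ 2) = t
  rcases Nat.even_or_odd' n with ⟨N, rfl | rfl⟩
  · rcases N with _ | N
    · have h := eval_terminatingHypergeometric 0 ((a + b + 2) / 2) ((a + 1) / 2) t
      simp only [terminatingHypergeometric, ordinaryHypergeometricCoefficient] at h
      simp [bigMinusOneJacobi, bigMinusOneMain, bigMinusOneAux, bigMinusOneFactor,
        shiftedJacobi_zero, ht] at h ⊢
      exact h.symm
    · have hc := terminatingHypergeometric_contiguous_upper N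
        ((N + 1 : ℕ) + (a + 1) / 2 + (b + 1) / 2 - 1) hp
      have e1 : (2 * (N + 1) + 1) / 2 = N + 1 := by lia
      have e2 : (2 * (N + 1) - 1) / 2 = N := by lia
      have e3 : 2 * (N + 1) / 2 = N + 1 := by lia
      simp only [bigMinusOneJacobi, bigMinusOneMain, bigMinusOneAux, bigMinusOneFactor,
        even_two_mul, if_true, e1, e2, e3, ht, shiftedJacobi]
      rw [← hc]
      have f1 : -((2 * (N + 1) : ℕ) : ℝ) / 2 = -((N + 1 : ℕ) : ℝ) := by push_cast; ring
      have f2 : 1 - ((2 * (N + 1) : ℕ) : ℝ) / 2 = -(N : ℝ) := by push_cast; ring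
      have f3 : (a + 3) / 2 = (a + 1) / 2 + 1 := by ring
      rw [f1, f2, f3, ← eval_terminatingHypergeometric, ← eval_terminatingHypergeometric]
      have f4 : (((2 * (N + 1) : ℕ) : ℝ) + a + b + 2) / 2
        = (N + 1 : ℕ) + (a + 1) / 2 + (b + 1) / 2 - 1 + 1 := by push_cast; ring
      have f5 : (N : ℝ) + ((a + 1) / 2 + 1) + ((b + 1) / 2 + 1) - 1
        = (N + 1 : ℕ) + (a + 1) / 2 + (b + 1) / 2 - 1 + 1 := by push_cast; ring
      rw [f4, f5]
      simp only [eval_sub, eval_add, eval_mul, eval_C, eval_X]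
      push_cast
      simp only [div_eq_mul_inv, mul_inv, inv_inv]
      field_simp
      ring
  · have hc := terminatingHypergeometric_contiguous_lower N
      ((N + 1 : ℕ) + (a + 1) / 2 + (b + 1) / 2 - 1) hp
    have e1 : (2 * N + 1 + 1) / 2 = N + 1 := by lia
    have e2 : (2 * N + 1 - 1) / 2 = N := by lia
    have e3 : (2 * N + 1) / 2 = N := by lia
    have e4 : ¬ Even (2 * N + 1) := by simp
    simp only [bigMinusOneJacobi, bigMinusOneMain, bigMinusOneAux, bigMinusOneFactor,
      e4, if_false, e1, e2, e3, ht, shiftedJacobi]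
    rw [← hc]
    have f1 : -(((2 * N + 1 : ℕ) : ℝ) - 1) / 2 = -(N : ℝ) := by push_cast; ring
    have f3 : (a + 3) / 2 = (a + 1) / 2 + 1 := by ring
    rw [f1, f3, ← eval_terminatingHypergeometric, ← eval_terminatingHypergeometric]
    have f4 : (((2 * N + 1 : ℕ) : ℝ) + a + b + 1) / 2
      = (N + 1 : ℕ) + (a + 1) / 2 + (b + 1) / 2 - 1 := by push_cast; ring
    have f5 : (N : ℝ) + ((a + 1) / 2 + 1) + ((b + 1) / 2 + 1) - 1
      = (N + 1 : ℕ) + (a + 1) / 2 + (b + 1) / 2 - 1 + 1 := by push_cast; ring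
    have f6 : (((2 * N + 1 : ℕ) : ℝ) + a + b + 3) / 2
      = (N + 1 : ℕ) + (a + 1) / 2 + (b + 1) / 2 - 1 + 1 := by push_cast; ring
    rw [f4, f5, f6]
    simp only [eval_sub, eval_mul, eval_C, eval_X]
    push_cast
    field_simp
    ring

/-- The quadratic form of `J_n` and `J_m` after the substitution `t = (1 - x ^ 2) / (1 - c ^ 2)`. -/
theorem betaMoment_main_add_aux {a b : ℝ} (ha : -1 < a) (hb : -1 < b) (n m : ℕ) :
    betaMoment ((a + 1) / 2) ((b + 1) / 2)
        (bigMinusOneMain n ((a + 1) / 2) ((b + 1) / 2)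
          * bigMinusOneMain m ((a + 1) / 2) ((b + 1) / 2))
      + betaMoment ((a + 1) / 2 + 1) ((b + 1) / 2 + 1)
        (bigMinusOneAux n ((a + 1) / 2) ((b + 1) / 2)
          * bigMinusOneAux m ((a + 1) / 2) ((b + 1) / 2))
      = if n = m then bigMinusOneH n a b else 0 := by
  obtain ⟨p, hp⟩ : ∃ p, p = (a + 1) / 2 := ⟨_, rfl⟩
  obtain ⟨r, hr⟩ : ∃ r, r = (b + 1) / 2 := ⟨_, rfl⟩
  obtain rfl : a = 2 * p - 1 := by linarith
  obtain rfl : b = 2 * r - 1 := by linarith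
  have hp0 : 0 < p := by linarith
  have hr0 : 0 < r := by linarith
  rw [← hp, ← hr]
  have haux (n m : ℕ) : betaMoment (p + 1) (r + 1) (bigMinusOneAux n p r * bigMinusOneAux m p r)
      = bigMinusOneFactor n p r * bigMinusOneFactor m p r * betaMoment (p + 1) (r + 1)
        (shiftedJacobi ((n - 1) / 2) (p + 1) (r + 1)
          * shiftedJacobi ((m - 1) / 2) (p + 1) (r + 1)) := by
    rw [bigMinusOneAux, bigMinusOneAux, mul_mul_mul_comm, ← C_mul, betaMoment_C_mul]
  rw [haux]
  have hzero : bigMinusOneFactor 0 p r = 0 := by simp [bigMinusOneFactor]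
  have hodd (N : ℕ) : bigMinusOneFactor (2 * N + 1) p r = -(N + p + r) / p := by
    have e : (2 * N + 1) / 2 = N := by lia
    simp [bigMinusOneFactor, e]
  have heven (N : ℕ) : bigMinusOneFactor (2 * (N + 1)) p r = (N + 1) / p := by
    simp [bigMinusOneFactor]
  -- The indices 2N+1 and 2N+2 share the degrees of both Jacobi polynomials; only the scalar factors
  -- distinguish them.
  by_cases hK : (n + 1) / 2 = (m + 1) / 2
  · rw [bigMinusOneMain, bigMinusOneMain, ← hK]
    rcases hN : (n + 1) / 2 with _ | N
    · obtain rfl : n = 0 := by lia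
      obtain rfl : m = 0 := by lia
      have h := Real.Gamma_add_one hp0.ne'
      simp only [hzero, shiftedJacobi_zero, mul_one, betaMoment_one hp0 hr0, bigMinusOneH]
      simp
      rw [show (2 * p - 1 + 3) / 2 = p + 1 by ring,
        show (2 * p - 1 + (2 * r - 1) + 2) / 2 = p + r by ring, h]
      field_simp
    · rw [betaMoment_shiftedJacobi_succ hp0 hr0]
      have e1 : (n - 1) / 2 = N := by lia
      have e2 : (m - 1) / 2 = N := by lia
      rw [e1, e2]
      have hsq := betaMoment_shiftedJacobi_sq N (p := p + 1) (r := r + 1) (by positivity)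
        (by positivity) (by linarith)
      generalize betaMoment (p + 1) (r + 1) _ = B at hsq ⊢
      have h0 : 2 * (N : ℝ) + p + r + 1 ≠ 0 := by positivity
      have h1 : (N : ℝ) + p + r ≠ 0 := by positivity
      have h1' : (N : ℝ) + p + 1 ≠ 0 := by positivity
      have h3 : Real.Gamma (N + p + r + 1) ≠ 0 := (Real.Gamma_pos_of_pos (by positivity)).ne'
      have h4 := (ascPochhammer_pos N (p + 1) (by positivity)).ne'
      rw [show (N : ℝ) + (p + 1) + (r + 1) - 1 = N + p + r + 1 by ring,
        show 2 * (N : ℝ) + (p + 1) + (r + 1) - 1 = 2 * N + p + r + 1 by ring] at hsq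
      rw [mul_comm, ← eq_div_iff h0] at hsq
      have hn : n = 2 * N + 1 ∨ n = 2 * (N + 1) := by lia
      have hm : m = 2 * N + 1 ∨ m = 2 * (N + 1) := by lia
      rcases hn with rfl | rfl <;> rcases hm with rfl | rfl
      · have e3 : (2 * N + 1 - 1) / 2 = N := by lia
        have e4 : (2 * N + 1 + 1) / 2 = N + 1 := by lia
        have e5 : ¬ Even (2 * N + 1) := by simp
        rw [if_pos rfl, hodd, bigMinusOneH, if_neg e5, e3, e4, ascPochhammer_eval_succ_left,
          hsq]
        rw [show (2 * p - 1 + 1) / 2 = p by ring]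
        push_cast
        rw [show (2 * (N : ℝ) + 1 + (2 * r - 1) + 2) / 2 = N + (r + 1) by ring,
          show (2 * (N : ℝ) + 1 + (2 * p - 1) + 2) / 2 = N + (p + 1) by ring,
          show (2 * (N : ℝ) + 1 + (2 * p - 1) + (2 * r - 1) + 3) / 2 = N + p + r + 1 by ring]
        field_simp
        ring
      -- The product of the factors is -(N+1)(N+p+r)/p², the negative of the norm ratio, so the two
      -- integrals cancel.
      · rw [if_neg (by lia), hodd, heven]
        field_simp
        ring
      · rw [if_neg (by lia), hodd, heven]
        field_simp
        ring
      · have e3 : 2 * (N + 1) / 2 = N + 1 := by lia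
        rw [if_pos rfl, heven, bigMinusOneH, if_pos (even_two_mul _), e3,
          ascPochhammer_eval_succ_left, hsq, Nat.factorial_succ]
        rw [show (2 * p - 1 + 1) / 2 = p by ring]
        push_cast
        rw [show (2 * ((N : ℝ) + 1) + (2 * r - 1) + 1) / 2 = N + (r + 1) by ring,
          show (2 * ((N : ℝ) + 1) + (2 * p - 1) + 3) / 2 = N + (p + 1) + 1 by ring,
          show (2 * ((N : ℝ) + 1) + (2 * p - 1) + (2 * r - 1) + 2) / 2 = N + p + r + 1 by ring,
          Real.Gamma_add_one (s := N + (p + 1)) (by positivity),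
          show 2 * ((N : ℝ) + 1) + (2 * p - 1) + 1 = 2 * (N + p + 1) by ring]
        field_simp
        ring
  · rw [if_neg (by rintro rfl; exact hK rfl), bigMinusOneMain, bigMinusOneMain,
      betaMoment_shiftedJacobi_of_ne hp0 hr0 hK, zero_add]
    -- For index 0 the truncated degree (0-1)/2 = 0 agrees with that of indices 1 and 2, so the
    -- second integral vanishes through its factor rather than by orthogonality.
    rcases Nat.eq_zero_or_pos n with rfl | hn
    · rw [hzero]; simp
    rcases Nat.eq_zero_or_pos m with rfl | hm
    · rw [hzero]; simp
    · rw [betaMoment_shiftedJacobi_of_ne (by positivity) (by positivity) (by lia), mul_zero]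

end

/-! ### One-variable orthogonality by the substitution t = (1-x²)/(1-c²). -/

noncomputable section

open Polynomial

/-- The union of the two intervals `|c| ≤ |x| ≤ 1`. -/
def bigMinusOneSupport (c : ℝ) : Set ℝ := {x | |c| ≤ |x| ∧ |x| ≤ 1}

/-- The weight function of the one-variable Big -1 Jacobi polynomials. -/
def bigMinusOneWeightOne (a b c x : ℝ) : ℝ :=
  Real.sign x * (1 + x) * (x - c) * (1 - x ^ 2) ^ ((a - 1) / 2) * (x ^ 2 - c ^ 2) ^ ((b - 1) / 2)

/-- The even part of the weight, which pulls back the beta weight. -/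
def pulledBackBetaWeight (p r c x : ℝ) : ℝ :=
  2 * x * ((1 - x ^ 2) ^ (p - 1) * (x ^ 2 - c ^ 2) ^ (r - 1))

theorem image_one_sub_sq_div {c : ℝ} (hc : |c| < 1) :
    (fun x : ℝ => (1 - x ^ 2) / (1 - c ^ 2)) '' Ioo |c| 1 = Ioo 0 1 := by
  have h1 : 0 < 1 - c ^ 2 := by have := (sq_lt_one_iff_abs_lt_one c).2 hc; linarith
  ext t
  constructor
  · rintro ⟨x, ⟨hx1, hx2⟩, rfl⟩
    have hx0 : 0 < x := (abs_nonneg c).trans_lt hx1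
    have h2 : c ^ 2 < x ^ 2 := by rw [← sq_abs c]; gcongr
    have h3 : x ^ 2 < 1 := by nlinarith
    exact ⟨div_pos (by linarith) h1, (div_lt_one h1).2 (by linarith)⟩
  · rintro ⟨ht0, ht1⟩
    have h2 : 0 < t * (1 - c ^ 2) := mul_pos ht0 h1
    have h3 : t * (1 - c ^ 2) < 1 - c ^ 2 := by nlinarith
    have h4 : 0 ≤ 1 - t * (1 - c ^ 2) := by nlinarith [sq_nonneg c]
    refine ⟨√(1 - t * (1 - c ^ 2)), ⟨?_, ?_⟩, ?_⟩
    · exact Real.lt_sqrt_of_sq_lt (by rw [sq_abs]; linarith)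
    · rw [Real.sqrt_lt' one_pos]; linarith
    · simp only [Real.sq_sqrt h4]; field_simp; ring

theorem injOn_one_sub_sq_div {c : ℝ} (hc : |c| < 1) :
    InjOn (fun x : ℝ => (1 - x ^ 2) / (1 - c ^ 2)) (Ioo |c| 1) := by
  have h1 : 0 < 1 - c ^ 2 := by have := (sq_lt_one_iff_abs_lt_one c).2 hc; linarith
  intro x hx y hy h
  have hx0 : 0 < x := (abs_nonneg c).trans_lt hx.1
  have hy0 : 0 < y := (abs_nonneg c).trans_lt hy.1
  simp only [div_left_inj' h1.ne'] at h
  exact (pow_left_inj₀ hx0.le hy0.le two_ne_zero).1 (by linarith)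

/-- Here 1 - t = (x²-c²)/(1-c²), so the two powers and the Jacobian 2x/(1-c²) contribute the
exponent (p-1)+(r-1)+1 of 1-c². -/
theorem pulledBackBetaWeight_eq {p r c x : ℝ} (hc : |c| < 1) (hx : x ∈ Ioo |c| 1) :
    pulledBackBetaWeight p r c x = (1 - c ^ 2) ^ (p + r - 1)
      * (|-(2 * x) / (1 - c ^ 2)| * betaWeight p r ((1 - x ^ 2) / (1 - c ^ 2))) := by
  have h1 : 0 < 1 - c ^ 2 := by have := (sq_lt_one_iff_abs_lt_one c).2 hc; linarith
  have hx0 : 0 < x := (abs_nonneg c).trans_lt hx.1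
  have h2 : c ^ 2 < x ^ 2 := by rw [← sq_abs c]; have := hx.1; gcongr
  have h3 : x ^ 2 < 1 := by nlinarith [hx.2]
  have e1 : 1 - (1 - x ^ 2) / (1 - c ^ 2) = (x ^ 2 - c ^ 2) / (1 - c ^ 2) := by
    field_simp; ring
  have e2 : (1 - c ^ 2) ^ (p + r - 1)
      = (1 - c ^ 2) ^ (p - 1) * (1 - c ^ 2) ^ (r - 1) * (1 - c ^ 2) := by
    nth_rw 4 [← Real.rpow_one (1 - c ^ 2)]
    rw [← Real.rpow_add h1, ← Real.rpow_add h1]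
    ring_nf
  have h4 : (1 - c ^ 2) ^ (p - 1) ≠ 0 := (Real.rpow_pos_of_pos h1 _).ne'
  have h5 : (1 - c ^ 2) ^ (r - 1) ≠ 0 := (Real.rpow_pos_of_pos h1 _).ne'
  rw [betaWeight, e1, Real.div_rpow (by linarith) h1.le, Real.div_rpow (by linarith) h1.le, e2,
    neg_div, abs_neg, abs_of_pos (by positivity), pulledBackBetaWeight]
  field_simp

theorem hasDerivWithinAt_one_sub_sq_div (c x : ℝ) (s : Set ℝ) :
    HasDerivWithinAt (fun x : ℝ => (1 - x ^ 2) / (1 - c ^ 2)) (-(2 * x) / (1 - c ^ 2)) s x := by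
  have h := (((hasDerivAt_id x).pow 2).const_sub 1).div_const (1 - c ^ 2)
  simpa using h.hasDerivWithinAt

theorem integrableOn_pulledBackBetaWeight {p r c : ℝ} (hp : 0 < p) (hr : 0 < r) (hc : |c| < 1) :
    IntegrableOn (pulledBackBetaWeight p r c) (Ioo |c| 1) := by
  have h := integrableOn_betaWeight hp hr
  rw [← image_one_sub_sq_div hc, integrableOn_image_iff_integrableOn_abs_deriv_smul
    measurableSet_Ioo (fun x _ => hasDerivWithinAt_one_sub_sq_div c x _)
    (injOn_one_sub_sq_div hc)] at h
  refine IntegrableOn.congr_fun (h.const_mul ((1 - c ^ 2) ^ (p + r - 1)))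
    (fun x hx => ?_) measurableSet_Ioo
  exact (pulledBackBetaWeight_eq hc hx).symm

theorem setIntegral_eval_mul_pulledBackBetaWeight {p r c : ℝ} (hc : |c| < 1) (f : ℝ[X]) :
    ∫ x in Ioo |c| 1, f.eval ((1 - x ^ 2) / (1 - c ^ 2)) * pulledBackBetaWeight p r c x
      = (1 - c ^ 2) ^ (p + r - 1) * betaMoment p r f := by
  rw [betaMoment, ← image_one_sub_sq_div hc, integral_image_eq_integral_abs_deriv_smul
    measurableSet_Ioo (fun x _ => hasDerivWithinAt_one_sub_sq_div c x _)
    (injOn_one_sub_sq_div hc), ← integral_const_mul]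
  refine setIntegral_congr_fun measurableSet_Ioo fun x hx => ?_
  simp only [pulledBackBetaWeight_eq hc hx, smul_eq_mul]
  ring

theorem integrableOn_continuous_mul_pulledBackBetaWeight {p r c d : ℝ} (hp : 0 < p) (hr : 0 < r)
    (hc : |c| < 1) (hd : |d| ≤ |c|) {h : ℝ → ℝ} (hh : Continuous h) :
    IntegrableOn (fun x => h x * (x - d) * ((1 - x ^ 2) ^ (p - 1) * (x ^ 2 - c ^ 2) ^ (r - 1)))
      (Ioo |c| 1) := by
  obtain ⟨M, hM⟩ := isCompact_Icc.exists_bound_of_continuousOn (s := Icc |c| (1 : ℝ))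
    hh.continuousOn
  have key : IntegrableOn (fun x => (h x * ((x - d) / (2 * x))) * pulledBackBetaWeight p r c x)
      (Ioo |c| 1) := by
    refine Integrable.bdd_mul (c := M) (integrableOn_pulledBackBetaWeight hp hr hc)
      (Measurable.aestronglyMeasurable ?_) ?_
    · have := hh.measurable
      fun_prop
    · refine ae_restrict_of_forall_mem measurableSet_Ioo fun x hx => ?_
      have hx0 : 0 < x := (abs_nonneg c).trans_lt hx.1
      -- Since |d| ≤ |c| < x, one has |x-d| ≤ 2x; the quotient stays bounded even when c = 0 and x
      -- approaches 0.
      have h1 : ‖(x - d) / (2 * x)‖ ≤ 1 := by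
        rw [Real.norm_eq_abs, abs_div, abs_of_pos (by positivity : 0 < 2 * x), div_le_one
          (by positivity)]
        have := abs_sub x d
        rw [abs_of_pos hx0] at this
        linarith [hx.1]
      rw [norm_mul]
      have h2 := hM x (Ioo_subset_Icc_self hx)
      exact (mul_le_of_le_one_right (norm_nonneg _) h1).trans h2
  refine key.congr_fun (fun x hx => ?_) measurableSet_Ioo
  have hx0 : x ≠ 0 := ((abs_nonneg c).trans_lt hx.1).ne'
  simp only [pulledBackBetaWeight]
  field_simp

theorem bigMinusOneSupport_ae_eq (c : ℝ) :
    (Ioo |c| 1 ∪ Neg.neg ⁻¹' Ioo |c| 1 : Set ℝ) =ᵐ[volume] bigMinusOneSupport c := by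
  have hfin : volume ({|c|, 1, -|c|, -1} : Set ℝ) = 0 := (Set.toFinite _).measure_zero _
  filter_upwards [measure_eq_zero_iff_ae_notMem.1 hfin] with x hx
  simp only [mem_insert_iff, mem_singleton_iff, not_or] at hx
  obtain ⟨h1, h2, h3, h4⟩ := hx
  refine propext ?_
  change (x ∈ Ioo |c| 1 ∨ -x ∈ Ioo |c| 1) ↔ (|c| ≤ |x| ∧ |x| ≤ 1)
  have hc := abs_nonneg c
  generalize |c| = d at *
  simp only [mem_Ioo]
  constructor
  · rintro (⟨h5, h6⟩ | ⟨h5, h6⟩)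
    · rw [abs_of_pos (by linarith)]; constructor <;> linarith
    · rw [abs_of_neg (by linarith)]; constructor <;> linarith
  · rintro ⟨h5, h6⟩
    rcases le_total 0 x with h | h
    · rw [abs_of_nonneg h] at h5 h6
      exact Or.inl ⟨lt_of_le_of_ne h5 (Ne.symm h1), lt_of_le_of_ne h6 h2⟩
    · rw [abs_of_nonpos h] at h5 h6
      exact Or.inr ⟨lt_of_le_of_ne h5 fun e => h3 (by linarith),
        lt_of_le_of_ne h6 fun e => h4 (by linarith)⟩

theorem integrableOn_and_setIntegral_bigMinusOneSupport {c : ℝ} {F : ℝ → ℝ}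
    (h1 : IntegrableOn F (Ioo |c| 1)) (h2 : IntegrableOn (fun x => F (-x)) (Ioo |c| 1)) :
    IntegrableOn F (bigMinusOneSupport c) ∧
      ∫ x in bigMinusOneSupport c, F x = ∫ x in Ioo |c| 1, (F x + F (-x)) := by
  have hneg := Measure.measurePreserving_neg (volume : Measure ℝ)
  have hemb := (MeasurableEquiv.neg ℝ).measurableEmbedding
  have e : (fun x : ℝ => F (- -x)) = F := by simp
  have h3 : IntegrableOn F (Neg.neg ⁻¹' Ioo |c| 1) := by
    have := (hneg.integrableOn_comp_preimage hemb (f := fun x => F (-x)) (s := Ioo |c| 1)).2 h2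
    simpa [Function.comp_def] using this
  have h4 : ∫ x in Neg.neg ⁻¹' Ioo |c| 1, F x = ∫ x in Ioo |c| 1, F (-x) := by
    have := hneg.setIntegral_preimage_emb hemb (fun x => F (-x)) (Ioo |c| 1)
    simpa using this
  have hd : Disjoint (Ioo |c| 1) (Neg.neg ⁻¹' Ioo |c| 1) := by
    rw [Set.disjoint_left]
    intro x hx hx'
    have := hx'.1
    linarith [hx.1, abs_nonneg c]
  have hae := bigMinusOneSupport_ae_eq c
  refine ⟨(h1.union h3).congr_set_ae hae.symm, ?_⟩
  rw [← setIntegral_congr_set hae, setIntegral_union hd (measurableSet_Ioo.preimage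
    measurable_neg) h1 h3, h4, integral_add h1 h2]

/-- Integration of `A + (1 - x) B`, with `A` and `B` polynomials in `(1 - x ^ 2) / (1 - c ^ 2)`,
against the weight of the one-variable Big -1 Jacobi polynomials. -/
theorem integral_bigMinusOneWeightOne {a b c : ℝ} (ha : -1 < a) (hb : -1 < b) (hc : |c| < 1)
    (A B : ℝ[X]) {F : ℝ → ℝ} (hF : ∀ x, F x = A.eval ((1 - x ^ 2) / (1 - c ^ 2))
      + (1 - x) * B.eval ((1 - x ^ 2) / (1 - c ^ 2))) :
    IntegrableOn (fun x => F x * bigMinusOneWeightOne a b c x) (bigMinusOneSupport c) ∧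
    ∫ x in bigMinusOneSupport c, F x * bigMinusOneWeightOne a b c x
      = (1 - c ^ 2) ^ ((a + b + 2) / 2) / (1 + c)
        * betaMoment ((a + 1) / 2) ((b + 1) / 2) (A + C (1 + c) * (X * B)) := by
  obtain ⟨p, hp⟩ : ∃ p, p = (a + 1) / 2 := ⟨_, rfl⟩
  obtain ⟨r, hr⟩ : ∃ r, r = (b + 1) / 2 := ⟨_, rfl⟩
  obtain rfl : a = 2 * p - 1 := by linarith
  obtain rfl : b = 2 * r - 1 := by linarith
  have hp0 : 0 < p := by linarith
  have hr0 : 0 < r := by linarith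
  rw [← hp, ← hr]
  have h1c : 0 < 1 - c ^ 2 := by have := (sq_lt_one_iff_abs_lt_one c).2 hc; linarith
  have h1 : 0 < 1 + c := by linarith [(abs_lt.1 hc).1]
  have ep : (2 * p - 1 - 1) / 2 = p - 1 := by ring
  have er : (2 * r - 1 - 1) / 2 = r - 1 := by ring
  have hFc : Continuous F := by
    rw [funext hF]
    fun_prop
  have hplus : ∀ x ∈ Ioo |c| 1, F x * bigMinusOneWeightOne (2 * p - 1) (2 * r - 1) c x
      = (F x * (1 + x)) * (x - c) * ((1 - x ^ 2) ^ (p - 1) * (x ^ 2 - c ^ 2) ^ (r - 1)) := by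
    intro x hx
    rw [bigMinusOneWeightOne, Real.sign_of_pos ((abs_nonneg c).trans_lt hx.1), ep, er]
    ring
  have hminus : ∀ x ∈ Ioo |c| 1, F (-x) * bigMinusOneWeightOne (2 * p - 1) (2 * r - 1) c (-x)
      = (F (-x) * (1 - x)) * (x - -c) * ((1 - x ^ 2) ^ (p - 1) * (x ^ 2 - c ^ 2) ^ (r - 1)) := by
    intro x hx
    rw [bigMinusOneWeightOne, Real.sign_of_neg (neg_lt_zero.2 ((abs_nonneg c).trans_lt hx.1)),
      ep, er, neg_sq]
    ring
  have i1 := (integrableOn_continuous_mul_pulledBackBetaWeight hp0 hr0 hc le_rfl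
    (h := fun x => F x * (1 + x)) (by fun_prop)).congr_fun (fun x hx => (hplus x hx).symm)
    measurableSet_Ioo
  have i2 := (integrableOn_continuous_mul_pulledBackBetaWeight hp0 hr0 hc (abs_neg c).le
    (h := fun x => F (-x) * (1 - x)) (by fun_prop)).congr_fun (fun x hx => (hminus x hx).symm)
    measurableSet_Ioo
  obtain ⟨i3, i4⟩ := integrableOn_and_setIntegral_bigMinusOneSupport i1 i2
  refine ⟨i3, ?_⟩
  have hpow : (1 - c ^ 2) ^ ((2 * p - 1 + (2 * r - 1) + 2) / 2) / (1 + c)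
      = (1 - c) * (1 - c ^ 2) ^ (p + r - 1) := by
    rw [show (2 * p - 1 + (2 * r - 1) + 2) / 2 = (p + r - 1) + 1 by ring,
      Real.rpow_add_one h1c.ne']
    field_simp
    ring
  rw [i4, hpow, mul_assoc, ← setIntegral_eval_mul_pulledBackBetaWeight hc, ← integral_const_mul]
  -- Folding: (1+x)(x-c) + (1-x)(x+c) = 2x(1-c) multiplies A, while the two terms with B add up to
  -- 2x(1-x²), and 1-x² = (1-c)(1+c)t.
  refine setIntegral_congr_fun measurableSet_Ioo fun x hx => ?_
  rw [hplus x hx, hminus x hx]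
  simp only [pulledBackBetaWeight, hF, neg_sq, eval_add, eval_mul, eval_C,
    eval_X]
  have ht : (1 - x ^ 2) = (1 - c) * (1 + c) * ((1 - x ^ 2) / (1 - c ^ 2)) := by
    field_simp; ring
  generalize (1 - x ^ 2) / (1 - c ^ 2) = t at ht ⊢
  generalize ((1 - x ^ 2) ^ (p - 1) * (x ^ 2 - c ^ 2) ^ (r - 1)) = k
  linear_combination 2 * x * k * eval t B * ht

/-- The orthogonality relation of the one-variable Big -1 Jacobi polynomials. -/
theorem bigMinusOneJacobi_orthogonality {a b c : ℝ} (ha : -1 < a) (hb : -1 < b) (hc : |c| < 1)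
    (n m : ℕ) :
    IntegrableOn (fun x => bigMinusOneJacobi n a b c x * bigMinusOneJacobi m a b c x
      * bigMinusOneWeightOne a b c x) (bigMinusOneSupport c) ∧
    ∫ x in bigMinusOneSupport c, bigMinusOneJacobi n a b c x * bigMinusOneJacobi m a b c x
      * bigMinusOneWeightOne a b c x
      = if n = m then (1 - c ^ 2) ^ ((a + b + 2) / 2) / (1 + c) * bigMinusOneH n a b else 0 := by
  have h1c : 0 < 1 - c ^ 2 := by have := (sq_lt_one_iff_abs_lt_one c).2 hc; linarith
  have h1 : 1 + c ≠ 0 := by linarith [(abs_lt.1 hc).1]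
  have hp : 0 < (a + 1) / 2 := by linarith
  have hr : 0 < (b + 1) / 2 := by linarith
  have hform := betaMoment_main_add_aux ha hb n m
  have hn := bigMinusOneJacobi_eq_eval n ha b c
  have hm := bigMinusOneJacobi_eq_eval m ha b c
  set U := bigMinusOneMain n ((a + 1) / 2) ((b + 1) / 2)
  set V := bigMinusOneMain m ((a + 1) / 2) ((b + 1) / 2)
  set P := bigMinusOneAux n ((a + 1) / 2) ((b + 1) / 2)
  set Q := bigMinusOneAux m ((a + 1) / 2) ((b + 1) / 2)
  -- The product contains (1-x)², reduced by (1-x)² = 2(1-x) - (1-c²)t to the form A + (1-x)B.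
  have key := integral_bigMinusOneWeightOne ha hb hc
    ((U - X * P) * (V - X * Q) - C ((1 - c) / (1 + c)) * (X * (P * Q)))
    (C (1 / (1 + c)) * ((U - X * P) * Q + P * (V - X * Q)) + C (2 / (1 + c) ^ 2) * (P * Q))
    (F := fun x => bigMinusOneJacobi n a b c x * bigMinusOneJacobi m a b c x) (by
      intro x
      simp only [hn, hm, eval_add, eval_sub, eval_mul, eval_C, eval_X]
      have ht : (1 - x ^ 2) = (1 - c) * (1 + c) * ((1 - x ^ 2) / (1 - c ^ 2)) := by
        field_simp; ring
      generalize (1 - x ^ 2) / (1 - c ^ 2) = t at ht ⊢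
      field_simp
      linear_combination -(eval t P * eval t Q) * ht)
  refine ⟨key.1, key.2.trans ?_⟩
  -- The mixed terms in UQ and PV drop out; the remaining factor X(1-X) raises both beta parameters
  -- by one.
  have e : ((U - X * P) * (V - X * Q) - C ((1 - c) / (1 + c)) * (X * (P * Q))) + C (1 + c) * (X *
      (C (1 / (1 + c)) * ((U - X * P) * Q + P * (V - X * Q)) + C (2 / (1 + c) ^ 2) * (P * Q)))
      = U * V + X * (1 - X) * (P * Q) := by
    have e1 : (C (1 + c) * C (1 / (1 + c)) : ℝ[X]) = 1 := by
      rw [← C_mul, mul_one_div_cancel h1, C_1]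
    have e2 : (C (1 + c) * C (2 / (1 + c) ^ 2) : ℝ[X]) = C ((1 - c) / (1 + c)) + 1 := by
      rw [← C_mul, ← C_1, ← C_add]
      congr 1
      field_simp
      ring
    linear_combination (X * ((U - X * P) * Q + P * (V - X * Q))) * e1 + X * P * Q * e2
  rw [e, betaMoment_add hp hr, ← betaMoment_shift, hform, mul_ite, mul_zero]

end

/-! ### Geometry of the domain and positivity of the weight. -/

noncomputable section

open Polynomial

theorem Icc_neg_union_Icc_eq (d e : ℝ) :
    Icc (-|e|) (-|d|) ∪ Icc |d| |e| = {x : ℝ | |d| ≤ |x| ∧ |x| ≤ |e|} := by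
  ext x
  have hd := abs_nonneg d
  simp only [mem_union, mem_Icc, mem_ofPred_eq]
  rcases le_total 0 x with h | h
  · rw [abs_of_nonneg h]
    exact ⟨by rintro (⟨h1, h2⟩ | h1) <;> [constructor <;> linarith; exact h1], Or.inr⟩
  · rw [abs_of_nonpos h]
    exact ⟨by rintro (⟨h1, h2⟩ | ⟨h1, h2⟩) <;> constructor <;> linarith,
      fun h1 => Or.inl ⟨by linarith, by linarith⟩⟩

theorem bigMinusOneDx_eq (δ y : ℝ) : bigMinusOneDx δ y = {x | |δ| ≤ |x| ∧ |x| ≤ |y|} :=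
  Icc_neg_union_Icc_eq δ y

theorem bigMinusOneDy_eq (δ : ℝ) : bigMinusOneDy δ = bigMinusOneSupport δ := by
  have h := Icc_neg_union_Icc_eq δ 1
  rwa [abs_one] at h

theorem mem_bigMinusOneDomain {δ x y : ℝ} :
    (x, y) ∈ bigMinusOneDomain δ ↔ |δ| ≤ |x| ∧ |x| ≤ |y| ∧ |y| ≤ 1 := by
  rw [bigMinusOneDomain, mem_ofPred_eq, bigMinusOneDx_eq, bigMinusOneDy_eq]
  simp only [bigMinusOneSupport, mem_ofPred_eq]
  exact ⟨fun h => ⟨h.2.1, h.2.2, h.1.2⟩, fun h => ⟨⟨h.1.trans h.2.1, h.2.2⟩, h.1, h.2.1⟩⟩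

theorem measurableSet_bigMinusOneDx (δ y : ℝ) : MeasurableSet (bigMinusOneDx δ y) :=
  measurableSet_Icc.union measurableSet_Icc

theorem measurableSet_bigMinusOneDy (δ : ℝ) : MeasurableSet (bigMinusOneDy δ) :=
  measurableSet_Icc.union measurableSet_Icc

theorem measurableSet_bigMinusOneDomain (δ : ℝ) : MeasurableSet (bigMinusOneDomain δ) := by
  have h : bigMinusOneDomain δ
      = {p : ℝ × ℝ | |δ| ≤ |p.1|} ∩ ({p | |p.1| ≤ |p.2|} ∩ {p | |p.2| ≤ 1}) := by
    ext ⟨x, y⟩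
    exact mem_bigMinusOneDomain
  rw [h]
  have h1 : Measurable fun p : ℝ × ℝ => |p.1| := (continuous_abs.comp continuous_fst).measurable
  have h2 : Measurable fun p : ℝ × ℝ => |p.2| := (continuous_abs.comp continuous_snd).measurable
  exact (measurableSet_le measurable_const h1).inter
    ((measurableSet_le h1 h2).inter (measurableSet_le h2 measurable_const))

theorem sign_mul_sub_nonneg {d x : ℝ} (h : |d| ≤ |x|) : 0 ≤ Real.sign x * (x - d) := by
  rcases lt_trichotomy x 0 with hx | rfl | hx
  · rw [Real.sign_of_neg hx]
    rw [abs_of_neg hx] at h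
    linarith [neg_abs_le d]
  · simp
  · rw [Real.sign_of_pos hx]
    rw [abs_of_pos hx] at h
    linarith [le_abs_self d]

theorem sign_mul_sub_pos {d x : ℝ} (h : |d| < |x|) : 0 < Real.sign x * (x - d) := by
  refine lt_of_le_of_ne (sign_mul_sub_nonneg h.le) (Ne.symm (mul_ne_zero ?_ ?_))
  · rw [Ne, Real.sign_eq_zero_iff]
    rintro rfl
    exact absurd h (by simp)
  · intro h0
    rw [sub_eq_zero] at h0
    exact h.ne (by rw [h0])

/-- Trades the sign of y for |y|, so that every factor of W is separately nonnegative on the domain.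
-/
theorem sign_mul_div (x y z : ℝ) : Real.sign (x * y) * (z / y) = Real.sign x * z / |y| := by
  have hs : Real.sign (x * y) = Real.sign x * Real.sign y := by
    rcases lt_trichotomy x 0 with hx | rfl | hx <;> rcases lt_trichotomy y 0 with hy | rfl | hy
    · rw [Real.sign_of_pos (mul_pos_of_neg_of_neg hx hy), Real.sign_of_neg hx, Real.sign_of_neg hy]
      norm_num
    · simp
    · rw [Real.sign_of_neg (mul_neg_of_neg_of_pos hx hy), Real.sign_of_neg hx, Real.sign_of_pos hy]
      norm_num
    · simp
    · simp
    · simp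
    · rw [Real.sign_of_neg (mul_neg_of_pos_of_neg hx hy), Real.sign_of_pos hx, Real.sign_of_neg hy]
      norm_num
    · simp
    · rw [Real.sign_of_pos (mul_pos hx hy), Real.sign_of_pos hx, Real.sign_of_pos hy]
      norm_num
  rw [hs]
  rcases lt_trichotomy y 0 with hy | rfl | hy
  · rw [Real.sign_of_neg hy, abs_of_neg hy, div_neg]; ring
  · simp
  · rw [Real.sign_of_pos hy, abs_of_pos hy]; ring

theorem bigMinusOneWeight_eq (α β γ δ x y : ℝ) :
    bigMinusOneWeight α β γ δ x y = Real.sign x * (x - δ) / |y| * |y| ^ (β + γ) * (1 + y)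
      * (1 + x / y) * (1 - y ^ 2) ^ ((α - 1) / 2) * (1 - (x / y) ^ 2) ^ ((γ - 1) / 2)
      * ((x ^ 2 - δ ^ 2) / y ^ 2) ^ ((β - 1) / 2) := by
  rw [bigMinusOneWeight, ← sign_mul_div, div_pow]
  ring

theorem bigMinusOneWeight_nonneg (α β γ : ℝ) {δ x y : ℝ} (h1 : |δ| ≤ |x|) (h2 : |x| ≤ |y|)
    (h3 : |y| ≤ 1) : 0 ≤ bigMinusOneWeight α β γ δ x y := by
  have hxy : |x / y| ≤ 1 := by rw [abs_div]; exact div_le_one_of_le₀ h2 (abs_nonneg y)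
  have := sign_mul_sub_nonneg h1
  have h4 : 0 ≤ 1 + y := by linarith [(abs_le.1 h3).1]
  have h5 : 0 ≤ 1 + x / y := by linarith [(abs_le.1 hxy).1]
  have h6 : 0 ≤ 1 - y ^ 2 := sub_nonneg.2 ((sq_le_one_iff_abs_le_one y).2 h3)
  have h7 : 0 ≤ 1 - (x / y) ^ 2 := sub_nonneg.2 ((sq_le_one_iff_abs_le_one _).2 hxy)
  have h8 : 0 ≤ x ^ 2 - δ ^ 2 := sub_nonneg.2 (sq_le_sq.2 h1)
  rw [bigMinusOneWeight_eq]
  positivity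

theorem bigMinusOneWeight_pos (α β γ : ℝ) {δ x y : ℝ} (h1 : |δ| < |x|) (h2 : |x| < |y|)
    (h3 : |y| < 1) : 0 < bigMinusOneWeight α β γ δ x y := by
  have hy : 0 < |y| := (abs_nonneg x).trans_lt h2
  have hy0 : y ≠ 0 := abs_pos.1 hy
  have hxy : |x / y| < 1 := by rw [abs_div]; exact (div_lt_one hy).2 h2
  have := sign_mul_sub_pos h1
  have h4 : 0 < 1 + y := by linarith [(abs_lt.1 h3).1]
  have h5 : 0 < 1 + x / y := by linarith [(abs_lt.1 hxy).1]
  have h6 : 0 < 1 - y ^ 2 := sub_pos.2 ((sq_lt_one_iff_abs_lt_one y).2 h3)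
  have h7 : 0 < 1 - (x / y) ^ 2 := sub_pos.2 ((sq_lt_one_iff_abs_lt_one _).2 hxy)
  have h8 : 0 < x ^ 2 - δ ^ 2 := sub_pos.2 (sq_lt_sq.2 h1)
  rw [bigMinusOneWeight_eq]
  positivity

/-- The three slacks 1-ty, ty-sx, sx-|δ| sum to 1-|δ|; divided by it, they are the barycentric
coordinates. -/
theorem mem_bigMinusOneTriangle {δ : ℝ} (hδ : |δ| < 1) (s t : ℤˣ) {x y : ℝ} :
    (x, y) ∈ bigMinusOneTriangle δ s t
      ↔ |δ| ≤ ((s : ℤ) : ℝ) * x ∧ ((s : ℤ) : ℝ) * x ≤ ((t : ℤ) : ℝ) * y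
        ∧ ((t : ℤ) : ℝ) * y ≤ 1 := by
  have hs : (((s : ℤ) : ℝ)) * ((s : ℤ) : ℝ) = 1 := by
    rcases Int.units_eq_one_or s with rfl | rfl <;> simp
  have ht : (((t : ℤ) : ℝ)) * ((t : ℤ) : ℝ) = 1 := by
    rcases Int.units_eq_one_or t with rfl | rfl <;> simp
  rw [bigMinusOneTriangle]
  generalize ((s : ℤ) : ℝ) = s at *
  generalize ((t : ℤ) : ℝ) = t at *
  generalize |δ| = d at *
  have hd : 0 < 1 - d := by linarith
  rw [convexHull_insert (by simp), convexHull_pair, mem_convexJoin]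
  simp only [mem_singleton_iff, exists_eq_left, segment, mem_ofPred_eq, Prod.smul_mk,
    Prod.mk_add_mk, smul_eq_mul]
  constructor
  · rintro ⟨-, ⟨a, b, ha, hb, hab, rfl⟩, a', b', ha', hb', hab', h⟩
    simp only [Prod.smul_mk, Prod.mk_add_mk, smul_eq_mul, Prod.mk.injEq] at h
    obtain ⟨rfl, rfl⟩ := h
    have e1 : s * (a' * (s * d) + b' * (a * (s * d) + b * s)) = a' * d + b' * (a * d + b) := by
      linear_combination (a' * d + b' * (a * d + b)) * hs
    have e2 : t * (a' * (t * d) + b' * (a * t + b * t)) = a' * d + b' * (a + b) := by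
      linear_combination (a' * d + b' * (a + b)) * ht
    rw [e1, e2, hab]
    obtain rfl : a' = 1 - b' := by linarith
    obtain rfl : a = 1 - b := by linarith
    have h1 : 0 ≤ b' * b * (1 - d) := by positivity
    have h2 : 0 ≤ b' * (1 - b) * (1 - d) := by positivity
    have h3 : 0 ≤ (1 - b') * (1 - d) := by positivity
    refine ⟨?_, ?_, ?_⟩ <;> nlinarith
  · rintro ⟨h1, h2, h3⟩
    -- If ty = |δ|, the point is the first vertex and its projection to the opposite edge is
    -- arbitrary; otherwise the weights on that edge are obtained by dividing by ty - |δ|.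
    rcases eq_or_lt_of_le (h1.trans h2) with h4 | h4
    · refine ⟨(1 : ℝ) • (s * d, t) + (0 : ℝ) • (s, t), ⟨1, 0, by simp⟩, 1, 0, by simp, by simp,
        by simp, ?_⟩
      have h5 : s * x = d := by linarith
      simp only [Prod.smul_mk, Prod.mk_add_mk, smul_eq_mul, Prod.mk.injEq]
      constructor
      · linear_combination -s * h5 + x * hs
      · linear_combination t * h4 + y * ht
    · have h5 : t * y - d ≠ 0 := by linarith
      refine ⟨_, ⟨(t * y - s * x) / (t * y - d), (s * x - d) / (t * y - d),
        div_nonneg (by linarith) (by linarith), div_nonneg (by linarith) (by linarith),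
        by field_simp; ring, rfl⟩, (1 - t * y) / (1 - d), (t * y - d) / (1 - d),
        div_nonneg (by linarith) (by linarith), div_nonneg (by linarith) (by linarith),
        by field_simp; ring, ?_⟩
      simp only [Prod.smul_mk, Prod.mk_add_mk, smul_eq_mul, Prod.mk.injEq]
      constructor
      · field_simp
        linear_combination (1 - d) * x * hs
      · field_simp
        linear_combination (1 - d) * y * ht

theorem bigMinusOneDomain_eq_iUnion {δ : ℝ} (hδ : |δ| < 1) :
    bigMinusOneDomain δ = ⋃ (s : ℤˣ) (t : ℤˣ), bigMinusOneTriangle δ s t := by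
  ext ⟨x, y⟩
  simp only [mem_iUnion, mem_bigMinusOneTriangle hδ, mem_bigMinusOneDomain]
  have habs (z : ℝ) : ∃ s : ℤˣ, ((s : ℤ) : ℝ) * z = |z| := by
    rcases le_total 0 z with h | h
    · exact ⟨1, by simp [abs_of_nonneg h]⟩
    · exact ⟨-1, by simp [abs_of_nonpos h]⟩
  constructor
  · intro h
    obtain ⟨s, hs⟩ := habs x
    obtain ⟨t, ht⟩ := habs y
    exact ⟨s, t, by rwa [hs, ht]⟩
  · rintro ⟨s, t, h1, h2, h3⟩
    have e (s : ℤˣ) (z : ℝ) : |((s : ℤ) : ℝ) * z| = |z| := by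
      rcases Int.units_eq_one_or s with rfl | rfl <;> simp
    have hd := abs_nonneg δ
    have h4 : 0 ≤ ((s : ℤ) : ℝ) * x := by linarith
    have h5 : 0 ≤ ((t : ℤ) : ℝ) * y := by linarith
    rw [← e s x, ← e t y, abs_of_nonneg h4, abs_of_nonneg h5]
    exact ⟨h1, h2, h3⟩

/-- For δ ≠ 0 both coordinates are nonzero on each triangle, and their signs determine s and t. -/
theorem disjoint_bigMinusOneTriangle {δ : ℝ} (hδ : |δ| < 1) (h0 : δ ≠ 0) {s t s' t' : ℤˣ}
    (h : (s, t) ≠ (s', t')) :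
    Disjoint (bigMinusOneTriangle δ s t) (bigMinusOneTriangle δ s' t') := by
  rw [Set.disjoint_left]
  rintro ⟨x, y⟩ h1 h2
  rw [mem_bigMinusOneTriangle hδ] at h1 h2
  have hd : 0 < |δ| := abs_pos.2 h0
  have e (s s' : ℤˣ) (z : ℝ) (h1 : 0 < ((s : ℤ) : ℝ) * z) (h2 : 0 < ((s' : ℤ) : ℝ) * z) :
      s = s' := by
    rcases Int.units_eq_one_or s with rfl | rfl <;> rcases Int.units_eq_one_or s' with rfl | rfl <;>
      simp at h1 h2 ⊢ <;> linarith
  exact h (Prod.ext (e s s' x (by linarith) (by linarith)) (e t t' y (by linarith) (by linarith)))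

end

/-! ### Fibre integration and orthogonality in two variables. -/

noncomputable section

open Polynomial

/-- Joint measurability in c and x is needed because c = δ/y varies with the fibre; it is read off
from the polynomial form. -/
theorem measurable_bigMinusOneJacobi {X : Type*} [MeasurableSpace X] (n : ℕ) {a : ℝ} (ha : -1 < a)
    (b : ℝ) {c x : X → ℝ} (hc : Measurable c) (hx : Measurable x) :
    Measurable fun p => bigMinusOneJacobi n a b (c p) (x p) := by
  simp only [bigMinusOneJacobi_eq_eval n ha]
  have h (f : ℝ[X]) : Measurable fun p => f.eval ((1 - x p ^ 2) / (1 - c p ^ 2)) :=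
    f.continuous.measurable.comp (by fun_prop)
  have h1 := h (bigMinusOneAux n ((a + 1) / 2) ((b + 1) / 2))
  have h2 := h (bigMinusOneMain n ((a + 1) / 2) ((b + 1) / 2)
    - Polynomial.X * bigMinusOneAux n ((a + 1) / 2) ((b + 1) / 2))
  fun_prop

theorem measurable_bivariateBigMinusOneJacobi {α β γ : ℝ} (hα : -1 < α) (hγ : -1 < γ) (δ : ℝ)
    (n k : ℕ) :
    Measurable fun p : ℝ × ℝ => bivariateBigMinusOneJacobi α β γ δ n k p.1 p.2 := by
  have h1 := measurable_bigMinusOneJacobi (n - k) hα (2 * k + β + γ + 1)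
    (measurable_const (a := (-1) ^ k * δ)) (measurable_snd (α := ℝ) (β := ℝ))
  have h2 := measurable_bigMinusOneJacobi k hγ β
    (c := fun p : ℝ × ℝ => δ / p.2) (x := fun p : ℝ × ℝ => p.1 / p.2) (by fun_prop) (by fun_prop)
  have h3 : Measurable fun p : ℝ × ℝ => bigMinusOneRho δ k p.2 := by
    unfold bigMinusOneRho
    split_ifs <;> fun_prop
  exact (h1.mul h3).mul h2

theorem measurable_bigMinusOneWeight (α β γ δ : ℝ) :
    Measurable fun p : ℝ × ℝ => bigMinusOneWeight α β γ δ p.1 p.2 := by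
  have h : Measurable Real.sign :=
    Measurable.ite measurableSet_Iio measurable_const
      (Measurable.ite measurableSet_Ioi measurable_const measurable_const)
  have h1 : Measurable fun p : ℝ × ℝ => Real.sign (p.1 * p.2) := h.comp (by fun_prop)
  have h2 : Measurable fun p : ℝ × ℝ => |p.2| := by fun_prop
  unfold bigMinusOneWeight
  fun_prop

/-- Scaling of the fibre `D_x(y)` onto the support of the one-variable weight. -/
theorem bigMinusOneDx_indicator_comp_mul {δ y : ℝ} (hy : y ≠ 0) (g : ℝ → ℝ) (u : ℝ) :
    (bigMinusOneDx δ y).indicator g (y * u)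
      = (bigMinusOneSupport (δ / y)).indicator (fun u => g (y * u)) u := by
  have hy' := abs_pos.2 hy
  have h : y * u ∈ bigMinusOneDx δ y ↔ u ∈ bigMinusOneSupport (δ / y) := by
    rw [bigMinusOneDx_eq]
    change |δ| ≤ |y * u| ∧ |y * u| ≤ |y| ↔ |δ / y| ≤ |u| ∧ |u| ≤ 1
    rw [abs_mul, abs_div, div_le_iff₀' hy', mul_le_iff_le_one_right hy']
  by_cases hu : u ∈ bigMinusOneSupport (δ / y)
  · rw [indicator_of_mem hu, indicator_of_mem (h.2 hu)]
  · rw [indicator_of_notMem hu, indicator_of_notMem (mt h.1 hu)]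

theorem measurableSet_bigMinusOneSupport (c : ℝ) : MeasurableSet (bigMinusOneSupport c) := by
  rw [← bigMinusOneDy_eq]
  exact measurableSet_bigMinusOneDy c

theorem setIntegral_bigMinusOneDx {δ y : ℝ} (hy : y ≠ 0) (g : ℝ → ℝ) :
    ∫ x in bigMinusOneDx δ y, g x = |y| * ∫ u in bigMinusOneSupport (δ / y), g (y * u) := by
  rw [← integral_indicator (measurableSet_bigMinusOneDx δ y),
    ← integral_indicator (measurableSet_bigMinusOneSupport _)]
  simp only [← bigMinusOneDx_indicator_comp_mul hy]
  rw [Measure.integral_comp_mul_left, smul_eq_mul, abs_inv, mul_inv_cancel_left₀ (abs_ne_zero.2 hy)]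

theorem integrableOn_bigMinusOneDx {δ y : ℝ} (hy : y ≠ 0) {g : ℝ → ℝ}
    (hg : IntegrableOn (fun u => g (y * u)) (bigMinusOneSupport (δ / y))) :
    IntegrableOn g (bigMinusOneDx δ y) := by
  rw [← integrable_indicator_iff (measurableSet_bigMinusOneDx δ y),
    ← integrable_comp_mul_left_iff _ hy]
  simp only [bigMinusOneDx_indicator_comp_mul hy]
  exact hg.integrable_indicator (measurableSet_bigMinusOneSupport _)

theorem bigMinusOneWeight_mul_left (α β γ δ : ℝ) {y : ℝ} (hy : y ≠ 0) (u : ℝ) :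
    bigMinusOneWeight α β γ δ (y * u) y = |y| ^ (β + γ) * (1 + y) * (1 - y ^ 2) ^ ((α - 1) / 2)
      * bigMinusOneWeightOne γ β (δ / y) u := by
  have hs : Real.sign (y * u * y) = Real.sign u := by
    rw [show y * u * y = y ^ 2 * u by ring]
    rcases lt_trichotomy u 0 with h | rfl | h
    · rw [Real.sign_of_neg h, Real.sign_of_neg (mul_neg_of_pos_of_neg (by positivity) h)]
    · simp
    · rw [Real.sign_of_pos h, Real.sign_of_pos (by positivity)]
  have e1 : (y * u - δ) / y = u - δ / y := by field_simp
  have e2 : (y * u) ^ 2 / y ^ 2 = u ^ 2 := by field_simp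
  have e3 : ((y * u) ^ 2 - δ ^ 2) / y ^ 2 = u ^ 2 - (δ / y) ^ 2 := by field_simp
  have e4 : y * u / y = u := by field_simp
  rw [bigMinusOneWeight, bigMinusOneWeightOne, hs, e1, e2, e3, e4]
  ring

/-- This explains the shape of ρ_k. With s = y²-δ², the factor s/(1+δ/y) from the fibre norm
supplies y-δ. For odd k the extra (1+δ/y)² in ρ_k², which replaces one power of 1-δ²/y², changes
this to y+δ: hence (-1)^k δ. -/
theorem bigMinusOneRho_sq_mul {δ y : ℝ} (h : |δ| < |y|) (β γ : ℝ) (k : ℕ) :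
    bigMinusOneRho δ k y ^ 2 * (|y| * |y| ^ (β + γ))
        * ((1 - (δ / y) ^ 2) ^ ((γ + β + 2) / 2) / (1 + δ / y))
      = Real.sign y * (y - (-1) ^ k * δ)
        * (y ^ 2 - ((-1) ^ k * δ) ^ 2) ^ ((2 * k + β + γ + 1 - 1) / 2) := by
  have hy : 0 < |y| := (abs_nonneg δ).trans_lt h
  have hy0 : y ≠ 0 := abs_pos.1 hy
  obtain ⟨s, hs⟩ : ∃ s, s = y ^ 2 - δ ^ 2 := ⟨_, rfl⟩
  have hs0 : 0 < s := by rw [hs]; exact sub_pos.2 (sq_lt_sq.2 h)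
  have hyd : y + δ ≠ 0 := by
    intro h0
    rw [eq_neg_of_add_eq_zero_left h0, abs_neg] at h
    exact h.false
  have hk2 : ((-1 : ℝ) ^ k * δ) ^ 2 = δ ^ 2 := by
    rw [mul_pow, ← pow_mul, mul_comm k, pow_mul]; simp
  have e1 : 1 - (δ / y) ^ 2 = s / |y| ^ 2 := by rw [hs, sq_abs]; field_simp
  have e2 : (1 - (δ / y) ^ 2) ^ ((γ + β + 2) / 2) * |y| ^ (β + γ)
      = s ^ ((β + γ) / 2) * s / |y| ^ 2 := by
    rw [e1, show (γ + β + 2) / 2 = (β + γ) / 2 + 1 by ring, Real.rpow_add_one (by positivity),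
      Real.div_rpow hs0.le (by positivity), ← Real.rpow_natCast |y| 2, ← Real.rpow_mul hy.le,
      show ((2 : ℕ) : ℝ) * ((β + γ) / 2) = β + γ by push_cast; ring]
    have := (Real.rpow_pos_of_pos hy (β + γ)).ne'
    rw [Real.rpow_natCast]
    field_simp
  have e3 : s ^ ((2 * k + β + γ + 1 - 1) / 2) = s ^ k * s ^ ((β + γ) / 2) := by
    rw [← Real.rpow_natCast s k, ← Real.rpow_add hs0]
    ring_nf
  have e4 : Real.sign y * |y| = y := by
    rcases lt_or_gt_of_ne hy0 with h | h
    · rw [Real.sign_of_neg h, abs_of_neg h]; ring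
    · rw [Real.sign_of_pos h, abs_of_pos h]; ring
  have e5 : Real.sign y = y / |y| := by rw [eq_div_iff hy.ne', e4]
  have e6 : 1 - δ ^ 2 / y ^ 2 = s / y ^ 2 := by rw [hs]; field_simp
  have e7 : 1 + δ / y = (y + δ) / y := by field_simp
  rw [hk2, ← hs, e3]
  have e8 : bigMinusOneRho δ k y ^ 2 * (|y| * |y| ^ (β + γ))
      * ((1 - (δ / y) ^ 2) ^ ((γ + β + 2) / 2) / (1 + δ / y))
      = bigMinusOneRho δ k y ^ 2 * |y| * (s ^ ((β + γ) / 2) * s / |y| ^ 2) / (1 + δ / y) := by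
    rw [← e2]; ring
  rw [e8, e5]
  generalize s ^ ((β + γ) / 2) = z
  rcases Nat.even_or_odd' k with ⟨j, rfl | rfl⟩
  · have f1 : 2 * j / 2 = j := by lia
    rw [bigMinusOneRho, if_pos (even_two_mul j), f1, e6, e7, pow_mul (-1 : ℝ)]
    simp only [neg_one_sq, one_pow, one_mul, div_pow, ← pow_mul]
    rw [hs]
    field_simp
    ring
  · have f1 : (2 * j + 1 - 1) / 2 = j := by lia
    have f2 : ¬ Even (2 * j + 1) := by simp
    rw [bigMinusOneRho, if_neg f2, f1, e6, e7, pow_succ (-1 : ℝ), pow_mul (-1 : ℝ)]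
    simp only [neg_one_sq, one_pow, one_mul, div_pow, ← pow_mul]
    field_simp
    ring

variable {α β γ δ : ℝ}

/-- The fibre integral of the product of two bivariate polynomials. -/
theorem integral_bigMinusOneDx_bivariate (hβ : -1 < β) (hγ : -1 < γ) {y : ℝ} (h : |δ| < |y|)
    (n k m l : ℕ) :
    IntegrableOn (fun x => bivariateBigMinusOneJacobi α β γ δ n k x y
        * bivariateBigMinusOneJacobi α β γ δ m l x y * bigMinusOneWeight α β γ δ x y)
      (bigMinusOneDx δ y) ∧
    ∫ x in bigMinusOneDx δ y, bivariateBigMinusOneJacobi α β γ δ n k x y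
        * bivariateBigMinusOneJacobi α β γ δ m l x y * bigMinusOneWeight α β γ δ x y
      = if k = l then bigMinusOneH k γ β
          * (bigMinusOneJacobi (n - k) α (2 * k + β + γ + 1) ((-1) ^ k * δ) y
            * bigMinusOneJacobi (m - k) α (2 * k + β + γ + 1) ((-1) ^ k * δ) y
            * bigMinusOneWeightOne α (2 * k + β + γ + 1) ((-1) ^ k * δ) y) else 0 := by
  have hy : 0 < |y| := (abs_nonneg δ).trans_lt h
  have hy0 : y ≠ 0 := abs_pos.1 hy
  have hc : |δ / y| < 1 := by rw [abs_div]; exact (div_lt_one hy).2 h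
  obtain ⟨i1, i2⟩ := bigMinusOneJacobi_orthogonality hγ hβ hc k l
  obtain ⟨A, hA⟩ : ∃ A, A = bigMinusOneJacobi (n - k) α (2 * k + β + γ + 1) ((-1) ^ k * δ) y
    * bigMinusOneJacobi (m - l) α (2 * l + β + γ + 1) ((-1) ^ l * δ) y
    * (bigMinusOneRho δ k y * bigMinusOneRho δ l y)
    * (|y| ^ (β + γ) * (1 + y) * (1 - y ^ 2) ^ ((α - 1) / 2)) := ⟨_, rfl⟩
  have e (u : ℝ) : bivariateBigMinusOneJacobi α β γ δ n k (y * u) y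
        * bivariateBigMinusOneJacobi α β γ δ m l (y * u) y * bigMinusOneWeight α β γ δ (y * u) y
      = A * (bigMinusOneJacobi k γ β (δ / y) u * bigMinusOneJacobi l γ β (δ / y) u
        * bigMinusOneWeightOne γ β (δ / y) u) := by
    have e4 : y * u / y = u := by field_simp
    rw [bigMinusOneWeight_mul_left α β γ δ hy0, bivariateBigMinusOneJacobi,
      bivariateBigMinusOneJacobi, e4, hA]
    ring
  constructor
  · apply integrableOn_bigMinusOneDx hy0
    simp only [e]
    exact i1.const_mul A
  · rw [setIntegral_bigMinusOneDx hy0]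
    simp only [e]
    rw [integral_const_mul, i2]
    split_ifs with hkl
    · subst hkl
      have hρ := bigMinusOneRho_sq_mul h β γ k
      rw [hA, bigMinusOneWeightOne]
      linear_combination bigMinusOneJacobi (n - k) α (2 * k + β + γ + 1) ((-1) ^ k * δ) y
        * bigMinusOneJacobi (m - k) α (2 * k + β + γ + 1) ((-1) ^ k * δ) y * (1 + y)
        * (1 - y ^ 2) ^ ((α - 1) / 2) * bigMinusOneH k γ β * hρ
    · simp

theorem abs_neg_one_pow_mul (k : ℕ) (δ : ℝ) : |(-1) ^ k * δ| = |δ| := by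
  rw [abs_mul, abs_pow, abs_neg, abs_one, one_pow, one_mul]

theorem bigMinusOneDy_orthogonality (hα : -1 < α) (hβ : -1 < β) (hγ : -1 < γ) (hδ : |δ| < 1)
    (k N M : ℕ) :
    IntegrableOn (fun y => bigMinusOneJacobi N α (2 * k + β + γ + 1) ((-1) ^ k * δ) y
            * bigMinusOneJacobi M α (2 * k + β + γ + 1) ((-1) ^ k * δ) y
            * bigMinusOneWeightOne α (2 * k + β + γ + 1) ((-1) ^ k * δ) y) (bigMinusOneDy δ) ∧
    ∫ y in bigMinusOneDy δ, bigMinusOneJacobi N α (2 * k + β + γ + 1) ((-1) ^ k * δ) y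
            * bigMinusOneJacobi M α (2 * k + β + γ + 1) ((-1) ^ k * δ) y
            * bigMinusOneWeightOne α (2 * k + β + γ + 1) ((-1) ^ k * δ) y
      = if N = M then (1 - δ ^ 2) ^ ((2 * k + α + β + γ + 3) / 2) / (1 + (-1) ^ k * δ)
          * bigMinusOneH N α (2 * k + β + γ + 1) else 0 := by
  have hk : (0 : ℝ) ≤ k := Nat.cast_nonneg k
  have h := bigMinusOneJacobi_orthogonality (b := 2 * k + β + γ + 1) hα (by linarith)
    (c := (-1) ^ k * δ) (by rwa [abs_neg_one_pow_mul]) N M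
  have hsupp : bigMinusOneSupport ((-1) ^ k * δ) = bigMinusOneDy δ := by
    rw [bigMinusOneDy_eq, bigMinusOneSupport, bigMinusOneSupport, abs_neg_one_pow_mul]
  have hsq : ((-1) ^ k * δ) ^ 2 = δ ^ 2 := by rw [← sq_abs, abs_neg_one_pow_mul, sq_abs]
  rw [hsupp, hsq, show (α + (2 * (k : ℝ) + β + γ + 1) + 2) / 2 = (2 * k + α + β + γ + 3) / 2 by
    ring] at h
  exact h

/-- Discards the two lines y = ±δ, where the fibre parameter δ/y is not in (-1, 1); for δ = 0 this
removes y = 0. -/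
theorem ae_abs_lt_abs (δ : ℝ) : ∀ᵐ y ∂volume.restrict (bigMinusOneDy δ), |δ| < |y| := by
  have hfin : volume ({δ, -δ} : Set ℝ) = 0 := (Set.toFinite _).measure_zero _
  rw [ae_restrict_iff' (measurableSet_bigMinusOneDy δ)]
  filter_upwards [measure_eq_zero_iff_ae_notMem.1 hfin] with y hy hmem
  rw [bigMinusOneDy_eq] at hmem
  refine lt_of_le_of_ne hmem.1 fun h => hy ?_
  rcases abs_eq_abs.1 h with h | h
  · exact Or.inl h.symm
  · exact Or.inr (by simp [h])

theorem integrableOn_bivariate_sq (hα : -1 < α) (hβ : -1 < β) (hγ : -1 < γ) (hδ : |δ| < 1)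
    (n k : ℕ) :
    IntegrableOn (fun p : ℝ × ℝ => bivariateBigMinusOneJacobi α β γ δ n k p.1 p.2
      * bivariateBigMinusOneJacobi α β γ δ n k p.1 p.2 * bigMinusOneWeight α β γ δ p.1 p.2)
      (bigMinusOneDomain δ) := by
  set f : ℝ × ℝ → ℝ := fun p => bivariateBigMinusOneJacobi α β γ δ n k p.1 p.2
      * bivariateBigMinusOneJacobi α β γ δ n k p.1 p.2 * bigMinusOneWeight α β γ δ p.1 p.2
  have hm : Measurable f := ((measurable_bivariateBigMinusOneJacobi (β := β) hα hγ δ n k).mul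
    (measurable_bivariateBigMinusOneJacobi (β := β) hα hγ δ n k)).mul
    (measurable_bigMinusOneWeight α β γ δ)
  have hnonneg : ∀ p ∈ bigMinusOneDomain δ, 0 ≤ f p := by
    rintro ⟨x, y⟩ hp
    obtain ⟨h1, h2, h3⟩ := mem_bigMinusOneDomain.1 hp
    exact mul_nonneg (mul_self_nonneg _) (bigMinusOneWeight_nonneg α β γ h1 h2 h3)
  have hind (x y : ℝ) : (bigMinusOneDomain δ).indicator f (x, y)
      = (bigMinusOneDy δ).indicator
        (fun y => (bigMinusOneDx δ y).indicator (fun x => f (x, y)) x) y := by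
    classical
    simp only [indicator_apply, bigMinusOneDomain, mem_ofPred_eq]
    split_ifs <;> simp_all
  rw [← integrable_indicator_iff (measurableSet_bigMinusOneDomain δ), Measure.volume_eq_prod,
    integrable_prod_iff' (hm.indicator (measurableSet_bigMinusOneDomain δ)).aestronglyMeasurable]
  have hae := (ae_restrict_iff' (measurableSet_bigMinusOneDy δ)).1 (ae_abs_lt_abs δ)
  constructor
  · filter_upwards [hae] with y hy
    simp only [hind]
    by_cases hmem : y ∈ bigMinusOneDy δ
    · simp only [indicator_of_mem hmem]
      exact (integral_bigMinusOneDx_bivariate hβ hγ (hy hmem) n k n k).1.integrable_indicator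
        (measurableSet_bigMinusOneDx δ y)
    · simp only [indicator_of_notMem hmem]
      exact integrable_zero _ _ _
  -- Nonnegativity removes the norm, so Tonelli's criterion concerns the fibre integral itself, a
  -- constant times a one-variable integrand already known to be integrable.
  · have hnorm (x y : ℝ) : ‖(bigMinusOneDomain δ).indicator f (x, y)‖
        = (bigMinusOneDomain δ).indicator f (x, y) := by
      rw [Real.norm_of_nonneg (indicator_nonneg hnonneg _)]
    simp only [hnorm]
    simp only [hind]
    have hlim := (integrable_indicator_iff (measurableSet_bigMinusOneDy δ)).2
      ((bigMinusOneDy_orthogonality hα hβ hγ hδ k (n - k) (n - k)).1.const_mul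
        (bigMinusOneH k γ β))
    refine hlim.congr ?_
    filter_upwards [hae] with y hy
    by_cases hmem : y ∈ bigMinusOneDy δ
    · simp only [indicator_of_mem hmem]
      rw [integral_indicator (measurableSet_bigMinusOneDx δ y),
        (integral_bigMinusOneDx_bivariate hβ hγ (hy hmem) n k n k).2, if_pos rfl]
    · simp only [indicator_of_notMem hmem, integral_zero]

/-- Domination by the squares: |fg| ≤ f² + g². -/
theorem integrableOn_bivariate_mul (hα : -1 < α) (hβ : -1 < β) (hγ : -1 < γ) (hδ : |δ| < 1)
    (n k m l : ℕ) :
    IntegrableOn (fun p : ℝ × ℝ => bivariateBigMinusOneJacobi α β γ δ n k p.1 p.2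
      * bivariateBigMinusOneJacobi α β γ δ m l p.1 p.2 * bigMinusOneWeight α β γ δ p.1 p.2)
      (bigMinusOneDomain δ) := by
  have hm := ((measurable_bivariateBigMinusOneJacobi (β := β) hα hγ δ n k).mul
    (measurable_bivariateBigMinusOneJacobi (β := β) hα hγ δ m l)).mul
    (measurable_bigMinusOneWeight α β γ δ)
  refine Integrable.mono' ((integrableOn_bivariate_sq hα hβ hγ hδ n k).norm.add
    (integrableOn_bivariate_sq hα hβ hγ hδ m l).norm) hm.aestronglyMeasurable
    (Filter.Eventually.of_forall fun p => ?_)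
  simp only [Pi.add_apply, norm_mul]
  have h0 := norm_nonneg (bigMinusOneWeight α β γ δ p.1 p.2)
  rw [← add_mul]
  refine mul_le_mul_of_nonneg_right ?_ h0
  nlinarith [sq_nonneg (‖bivariateBigMinusOneJacobi α β γ δ n k p.1 p.2‖
    - ‖bivariateBigMinusOneJacobi α β γ δ m l p.1 p.2‖),
    mul_self_nonneg ‖bivariateBigMinusOneJacobi α β γ δ n k p.1 p.2‖,
    mul_self_nonneg ‖bivariateBigMinusOneJacobi α β γ δ m l p.1 p.2‖]

theorem integral_bivariate_mul (hα : -1 < α) (hβ : -1 < β) (hγ : -1 < γ) (hδ : |δ| < 1)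
    {n k m l : ℕ} (hk : k ≤ n) (hl : l ≤ m) :
    ∫ y in bigMinusOneDy δ, ∫ x in bigMinusOneDx δ y,
        bivariateBigMinusOneJacobi α β γ δ n k x y
          * bivariateBigMinusOneJacobi α β γ δ m l x y
          * bigMinusOneWeight α β γ δ x y
      = if k = l ∧ n = m then bivariateBigMinusOneH α β γ δ n k else 0 := by
  rw [integral_congr_ae ((ae_abs_lt_abs δ).mono fun y hy =>
    (integral_bigMinusOneDx_bivariate (α := α) hβ hγ hy n k m l).2)]
  by_cases hkl : k = l
  · subst hkl
    simp only [if_true, true_and]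
    rw [integral_const_mul, (bigMinusOneDy_orthogonality hα hβ hγ hδ k (n - k) (m - k)).2,
      bivariateBigMinusOneH]
    by_cases hnm : n = m
    · subst hnm
      simp only [if_true]
      ring
    -- The subtractions are not truncated, as k ≤ n and k ≤ m, so n ≠ m gives n-k ≠ m-k.
    · rw [if_neg hnm, if_neg (by lia), mul_zero]
  · simp [hkl]

end

theorem proposition2p1 (α β γ δ : ℝ) (hα : -1 < α) (hβ : -1 < β) (hγ : -1 < γ) (hδ : |δ| < 1) :
    -- the domain is the union of four triangles, which are pairwise disjoint for `δ ≠ 0`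
    bigMinusOneDomain δ = (⋃ (s : ℤˣ) (t : ℤˣ), bigMinusOneTriangle δ s t) ∧
    (δ ≠ 0 → ∀ s t s' t' : ℤˣ, (s, t) ≠ (s', t') →
      Disjoint (bigMinusOneTriangle δ s t) (bigMinusOneTriangle δ s' t')) ∧
    -- the weight is positive inside the triangles
    (∀ x y : ℝ, |δ| < |x| → |x| < |y| → |y| < 1 → 0 < bigMinusOneWeight α β γ δ x y) ∧
    -- the orthogonality relation, with an absolutely convergent integral
    (∀ n k m l : ℕ, k ≤ n → l ≤ m →
      IntegrableOn (fun p : ℝ × ℝ =>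
        bivariateBigMinusOneJacobi α β γ δ n k p.1 p.2
          * bivariateBigMinusOneJacobi α β γ δ m l p.1 p.2
          * bigMinusOneWeight α β γ δ p.1 p.2) (bigMinusOneDomain δ) volume ∧
      (∫ y in bigMinusOneDy δ, ∫ x in bigMinusOneDx δ y,
        bivariateBigMinusOneJacobi α β γ δ n k x y
          * bivariateBigMinusOneJacobi α β γ δ m l x y
          * bigMinusOneWeight α β γ δ x y)
        = if k = l ∧ n = m then bivariateBigMinusOneH α β γ δ n k else 0) := by
  exact ⟨bigMinusOneDomain_eq_iUnion hδ,
    fun h0 _ _ _ _ h => disjoint_bigMinusOneTriangle hδ h0 h,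
    fun _ _ h1 h2 h3 => bigMinusOneWeight_pos α β γ h1 h2 h3,
    fun n k m l hk hl => ⟨integrableOn_bivariate_mul hα hβ hγ hδ n k m l,
      integral_bivariate_mul hα hβ hγ hδ hk hl⟩⟩
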